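/- **Theorem (Type-1 FCSA+FCC codes).** Let $\mathbb F$ be a finite field and $\mathcal S\subseteq[L_A]\times[L_B]$ a nonempty computation list: given $\mathbf A_1,\dots,\mathbf A_{L_A}\in\mathbb F^{\alpha\times\beta}$ and $\mathbf B_1,\dots,\mathbf B_{L_B}\in\mathbb F^{\beta\times\gamma}$ ($\alpha,\beta,\gamma\ge 1$), the products $\mathbf A_i\mathbf B_j$, $(i,j)\in\mathcal S$, are to be obtained from the answers of those among $K$ workers that respond. Put $d^A_i=|\{j:(i,j)\in\mathcal S\}|$ and $d^B_j=|\{i:(i,j)\in\mathcal S\}|$; matrices of degree $0$ are pruned. Let $m,p,n\ge1$ with $m\mid\alpha$, $p\mid\beta$, $n\mid\gamma$. Let $R=R_{m,p,n}$ be the bilinear complexity over $\mathbb F$ of multiplying an $m\times p$ by a $p\times n$ matrix, i.e. the least $R$ for which there are $a\in\mathbb F^{R\times m\times p}$, $b\in\mathbb F^{R\times p\times n}$, $c\in\mathbb F^{R\times m\times n}$ with $\sum_{i=1}^{R} c_{i,j,k}\big(\sum_{q,r}a_{i,q,r}X_{q,r}\big)\big(\sum_{r,s}b_{i,r,s}Y_{r,s}\big)=(XY)_{j,k}$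 for all $X,Y,j,k$. Let $\rho\mid R$ and assume $|\mathbb F|>R|\mathcal S|+K$. *The code.* The Type-1 task assignment makes each $q\in\mathcal S$, $q=(i_q,j_q)$, a task group $\mathcal L^q_A=\{i_q\}$, $\mathcal L^q_B=\{j_q\}$; a power assignment for it exists and necessarily has $P^{A,q}_{i_q}=P^{B,q}_{j_q}=1$, all its other entries being $0$. Choose tensors $a,b,c$ as above and distinct elements $f_{r,q}$ ($r\in[R]$, $q\in\mathcal S$), $x_1,\dots,x_K$ of $\mathbb F$; this is possible. Cut each $\mathbf A_i$ into $m\times p$ equal blocks $\mathbf A_i^{k,l}$ and each $\mathbf B_j$ into $p\times n$ equal blocks $\mathbf B_j^{k,l}$, and put $\mathbf A_i^r=\sum_{k,l}a_{r,k,l}\mathbf A_i^{k,l}$, $\mathbf B_j^r=\sum_{k,l}b_{r,k,l}\mathbf B_j^{k,l}$. For $h\in[R/\rho]$ let $I_h=\{(h-1)\rho+1,\dots,h\rho\}$ and $$\mathbf A^h(x)=\prod_{r\in I_h}\prod_{q\in\mathcal S}(x-f_{r,q})\sum_{i:\,d^A_i\ne0}\ \sum_{r\in I_h}\frac{\mathbf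 A_i^r}{\prod_{q}(x-f_{r,q})^{P^{A,q}_i}},\qquad \mathbf B^h(x)=\sum_{j:\,d^B_j\ne0}\ \sum_{r\in I_h}\frac{\mathbf B_j^r}{\prod_{q}(x-f_{r,q})^{P^{B,q}_j}} .$$ Worker $k$ receives $[\mathbf A^1(x_k)\ \cdots\ \mathbf A^{R/\rho}(x_k)]$ and the $\mathbf B^h(x_k)$, $h=1,\dots,R/\rho$, stacked vertically, and returns the product of the two. *Claim.* Put $$R^{T1}=(R_{m,p,n}+\rho)|\mathcal S|-\min_{i:\,d^A_i\neq0}d^A_i-\min_{j:\,d^B_j\neq0}d^B_j+1 .$$ For every such code there are decoding functions $d_{\mathcal R}$, $\mathcal R\subseteq[K]$, such that for every set $\mathcal R$ of at least $R^{T1}$ workers and for all inputs, $d_{\mathcal R}$ maps the responses of the workers in $\mathcal R$ to $(\mathbf A_i\mathbf B_j)_{(i,j)\in\mathcal S}$. If $R^{T1}\le K$, the recovery threshold of the code with these decoding functions (the least $r$ such that $d_{\mathcal R}$ returns the desired products on all inputs whenever $|\mathcal R|\ge r$) is $R^{T1}$. Moreover the decoding complexity is $$\mathcal O(\alpha\gamma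 R_{m,p,n}|\mathcal S|)+\widetilde{\mathcal O}\big(\alpha\gamma R^{T1}\log^2R^{T1}\big),$$ where $\widetilde{\mathcal O}(u\log^2v)$ means $\mathcal O(u\log^2v\,\log\log v)$. Precisely: there is an absolute constant $C$ (independent of $\mathbb F$ and of all parameters and choices) such that, for every $\mathcal R$ with $|\mathcal R|\ge R^{T1}$, $d_{\mathcal R}$ is computed, as a function of the entries of the responses, by a straight-line program over $\mathbb F$ with at most $C\big(\alpha\gamma R_{m,p,n}|\mathcal S|+\alpha\gamma R^{T1}\log^2(R^{T1})\max(1,\log\log R^{T1})\big)$ instructions, each instruction being an addition, subtraction or multiplication in $\mathbb F$ or the loading of a constant of $\mathbb F$. -/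

import Mathlib

open scoped BigOperators

namespace VCDBMM

/-! ## The bipartite graph of a computation list -/

section Graph

variable {LA LB : ℕ}

/-- Degree of the left vertex `i`: the number of requested products `A_i B_j`. -/
def degA (S : Finset (Fin LA × Fin LB)) (i : Fin LA) : ℕ :=
  (Finset.univ.filter fun j : Fin LB => (i, j) ∈ S).card

/-- Degree of the right vertex `j`. -/
def degB (S : Finset (Fin LA × Fin LB)) (j : Fin LB) : ℕ :=
  (Finset.univ.filter fun i : Fin LA => (i, j) ∈ S).card

/-- The left vertices that survive pruning, i.e. that occur in some requested product. -/
def activeA (S : Finset (Fin LA × Fin LB)) : Finset (Fin LA) :=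
  Finset.univ.filter fun i => degA S i ≠ 0

/-- The right vertices that survive pruning. -/
def activeB (S : Finset (Fin LA × Fin LB)) : Finset (Fin LB) :=
  Finset.univ.filter fun j => degB S j ≠ 0

/-- `min {d^A_i : d^A_i ≠ 0}` (the set is nonempty as soon as `S` is). -/
noncomputable def minDegA (S : Finset (Fin LA × Fin LB)) : ℕ :=
  sInf {d | ∃ i, degA S i ≠ 0 ∧ degA S i = d}

/-- `min {d^B_j : d^B_j ≠ 0}`. -/
noncomputable def minDegB (S : Finset (Fin LA × Fin LB)) : ℕ :=
  sInf {d | ∃ j, degB S j ≠ 0 ∧ degB S j = d}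

theorem fst_mem_activeA {S : Finset (Fin LA × Fin LB)} {s : Fin LA × Fin LB} (hs : s ∈ S) :
    s.1 ∈ activeA S := by
  have h : 0 < degA S s.1 :=
    Finset.card_pos.2 ⟨s.2, Finset.mem_filter.2 ⟨Finset.mem_univ _, hs⟩⟩
  exact Finset.mem_filter.2 ⟨Finset.mem_univ _, h.ne'⟩

theorem snd_mem_activeB {S : Finset (Fin LA × Fin LB)} {s : Fin LA × Fin LB} (hs : s ∈ S) :
    s.2 ∈ activeB S := by
  have h : 0 < degB S s.2 :=
    Finset.card_pos.2 ⟨s.1, Finset.mem_filter.2 ⟨Finset.mem_univ _, hs⟩⟩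
  exact Finset.mem_filter.2 ⟨Finset.mem_univ _, h.ne'⟩

/-! ## Task assignments and power assignments -/

/-- A task assignment for `S` (on the pruned graph) with task groups indexed by `Q`. -/
structure TaskAssignment (S : Finset (Fin LA × Fin LB)) (Q : Type) where
  groupA : Q → Finset (Fin LA)
  groupB : Q → Finset (Fin LB)
  groupA_subset : ∀ q, groupA q ⊆ activeA S
  groupB_subset : ∀ q, groupB q ⊆ activeB S
  disjoint : ∀ q q', q ≠ q' → Disjoint (groupA q ×ˢ groupB q) (groupA q' ×ˢ groupB q')
  covers : ∀ s ∈ S, ∃! q, s ∈ groupA q ×ˢ groupB q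

/-- The number `L^q_A * L^q_B` of products in the task group `q`. -/
def TaskAssignment.size {S : Finset (Fin LA × Fin LB)} {Q : Type} (T : TaskAssignment S Q)
    (q : Q) : ℕ :=
  (T.groupA q).card * (T.groupB q).card

/-- One of the two symmetric shapes allowed for the powers of a task group `(X, Y)`:
every power on `X` is `|X||Y| - x + 1` with `1 ≤ x ≤ |X|`, and every power on `Y` is `y|X|`
with `1 ≤ y ≤ |Y|`. -/
def PowerShape {I J : Type} (X : Finset I) (Y : Finset J) (u : I → ℕ) (v : J → ℕ) : Prop :=
  (∀ i ∈ X, ∃ x ∈ Finset.Icc 1 X.card, u i + x = X.card * Y.card + 1) ∧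
  (∀ j ∈ Y, ∃ y ∈ Finset.Icc 1 Y.card, v j = y * X.card)

/-- A power assignment for a task assignment. -/
structure PowerAssignment {S : Finset (Fin LA × Fin LB)} {Q : Type}
    (T : TaskAssignment S Q) where
  powA : Q → Fin LA → ℕ
  powB : Q → Fin LB → ℕ
  powA_eq_zero : ∀ q i, i ∉ T.groupA q → powA q i = 0
  powB_eq_zero : ∀ q j, j ∉ T.groupB q → powB q j = 0
  shape : ∀ q, PowerShape (T.groupA q) (T.groupB q) (powA q) (powB q) ∨
    PowerShape (T.groupB q) (T.groupA q) (powB q) (powA q)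
  powA_inj : ∀ q i i', powA q i ≠ 0 → powA q i = powA q i' → i = i'
  powB_inj : ∀ q j j', powB q j ≠ 0 → powB q j = powB q j' → j = j'

/-- The Type-1 task assignment: every requested product is its own task group. -/
def type1Tasks (S : Finset (Fin LA × Fin LB)) : TaskAssignment S {s // s ∈ S} where
  groupA s := {s.1.1}
  groupB s := {s.1.2}
  groupA_subset s := Finset.singleton_subset_iff.2 (fst_mem_activeA s.2)
  groupB_subset s := Finset.singleton_subset_iff.2 (snd_mem_activeB s.2)
  disjoint q q' h := by
    rw [Finset.singleton_product_singleton, Finset.singleton_product_singleton,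
      Finset.disjoint_singleton]
    exact fun e => h (Subtype.ext e)
  covers s hs := by
    refine ⟨⟨s, hs⟩, by simp, ?_⟩
    rintro ⟨t, ht⟩ h
    simp only [Finset.singleton_product_singleton, Finset.mem_singleton] at h
    exact Subtype.ext h.symm

end Graph

/-! ## Bilinear complexity of matrix multiplication -/

section Bilinear

variable {F : Type*} [Field F]

/-- The tensors `a, b, c` compute the product of an `m × p` and a `p × n` matrix over `F`
with `R` multiplications. -/
def IsBilinearAlgorithm {R m p n : ℕ} (a : Fin R → Matrix (Fin m) (Fin p) F)
    (b : Fin R → Matrix (Fin p) (Fin n) F) (c : Fin R → Matrix (Fin m) (Fin n) F) : Prop :=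
  ∀ (X : Matrix (Fin m) (Fin p) F) (Y : Matrix (Fin p) (Fin n) F) (j : Fin m) (k : Fin n),
    ∑ i, c i j k * (∑ q, ∑ r, a i q r * X q r) * (∑ r, ∑ s, b i r s * Y r s) = (X * Y) j k

variable (F) in
/-- The bilinear complexity `R_{m,p,n}` over `F`. -/
noncomputable def bilinearComplexity (m p n : ℕ) : ℕ :=
  sInf {R | ∃ (a : Fin R → Matrix (Fin m) (Fin p) F) (b : Fin R → Matrix (Fin p) (Fin n) F)
    (c : Fin R → Matrix (Fin m) (Fin n) F), IsBilinearAlgorithm a b c}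

end Bilinear

/-! ## Straight-line programs over a field -/

section StraightLine

/-- One instruction of a straight-line program: load a constant, or apply a field operation to
two operands. An operand is an input (`Sum.inl i`) or the result of the `t`-th instruction,
counted from `0` (`Sum.inr t`). -/
inductive Instr (F ι : Type*) where
  | const (c : F)
  | add (u v : ι ⊕ ℕ)
  | sub (u v : ι ⊕ ℕ)
  | mul (u v : ι ⊕ ℕ)

variable {F ι κ : Type*} [Field F]

/-- Value of an operand, given the inputs and the results so far. (The result of an instruction
that has not been executed reads as `0`.) -/
def operandValue (x : ι → F) (regs : List F) : ι ⊕ ℕ → F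
  | Sum.inl i => x i
  | Sum.inr t => regs.getD t 0

/-- Result of one instruction. -/
def Instr.value (x : ι → F) (regs : List F) : Instr F ι → F
  | .const c => c
  | .add u v => operandValue x regs u + operandValue x regs v
  | .sub u v => operandValue x regs u - operandValue x regs v
  | .mul u v => operandValue x regs u * operandValue x regs v

/-- Run a program: each instruction appends its result to the list of results. -/
def runProgram (x : ι → F) : List (Instr F ι) → List F → List F
  | [], regs => regs
  | s :: P, regs => runProgram x P (regs ++ [s.value x regs])

/-- The map `f` is computed by a straight-line program with at most `b` instructions. -/
def ComputableWithin (b : ℝ) (f : (ι → F) → κ → F) : Prop :=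
  ∃ P : List (Instr F ι), (P.length : ℝ) ≤ b ∧
    ∃ out : κ → ι ⊕ ℕ, ∀ x k, f x k = operandValue x (runProgram x P []) (out k)

end StraightLine

/-! ## Codes for the VCDBMM problem -/

section Codes

variable (F : Type*) [Field F] {LA LB : ℕ}

/-- A code `(f, g, d)`: worker `k` gets `encA k A` and `encB k B` and returns their product;
`dec W` is the decoding function used when `W` is the set of responding workers. -/
structure Code (α β γ : ℕ) (S : Finset (Fin LA × Fin LB)) (K : ℕ) where
  rows : Fin K → ℕ
  inner : Fin K → ℕ
  cols : Fin K → ℕ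
  encA : ∀ k, (Fin LA → Matrix (Fin α) (Fin β) F) → Matrix (Fin (rows k)) (Fin (inner k)) F
  encB : ∀ k, (Fin LB → Matrix (Fin β) (Fin γ) F) → Matrix (Fin (inner k)) (Fin (cols k)) F
  dec : ∀ W : Finset (Fin K),
    (∀ k : {k // k ∈ W}, Matrix (Fin (rows k.1)) (Fin (cols k.1)) F) →
      {s // s ∈ S} → Matrix (Fin α) (Fin γ) F

variable {F} {α β γ K : ℕ} {S : Finset (Fin LA × Fin LB)}

/-- Any `r` or more responses determine all requested products through the decoder. -/
def Code.RecoversFrom (c : Code F α β γ S K) (r : ℤ) : Prop :=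
  ∀ W : Finset (Fin K), r ≤ (W.card : ℤ) →
    ∀ (A : Fin LA → Matrix (Fin α) (Fin β) F) (B : Fin LB → Matrix (Fin β) (Fin γ) F),
      c.dec W (fun k => c.encA k.1 A * c.encB k.1 B) = fun s => A s.1.1 * B s.1.2

/-- The recovery threshold of a code: the least `r` from which it recovers. -/
noncomputable def Code.recoveryThreshold (c : Code F α β γ S K) : ℕ :=
  sInf {r : ℕ | c.RecoversFrom r}

/-- For every set of at least `r` responding workers, the decoding function (as a map from the
entries of the responses to the entries of the requested products) is computed by a straight-line
program with at most `b` instructions. -/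
def Code.DecodesWithin (c : Code F α β γ S K) (r : ℤ) (b : ℝ) : Prop :=
  ∀ W : Finset (Fin K), r ≤ (W.card : ℤ) →
    ComputableWithin b
      (fun (y : (Σ k : {k // k ∈ W}, Fin (c.rows k.1) × Fin (c.cols k.1)) → F)
        (o : {s // s ∈ S} × Fin α × Fin γ) =>
          c.dec W (fun k => Matrix.of fun u v => y ⟨k, (u, v)⟩) o.1 o.2.1 o.2.2)

end Codes

/-! ## FCSA+FCC codes -/

section FCSA

variable {F : Type*} [Field F]

/-- The block `(k, l)` of an `a × b` matrix that is cut into `m × p` equal contiguous blocks. -/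
def block {a b m p : ℕ} (hm : m ∣ a) (hp : p ∣ b) (X : Matrix (Fin a) (Fin b) F)
    (k : Fin m) (l : Fin p) : Matrix (Fin (a / m)) (Fin (b / p)) F :=
  Matrix.of fun u v => X (Fin.cast (Nat.mul_div_cancel' hm) (finProdFinEquiv (k, u)))
    (Fin.cast (Nat.mul_div_cancel' hp) (finProdFinEquiv (l, v)))

/-- The linear combination `∑ t_{k,l} X^{k,l}` of the blocks of `X`. -/
def mixBlocks {a b m p : ℕ} (hm : m ∣ a) (hp : p ∣ b) (t : Matrix (Fin m) (Fin p) F)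
    (X : Matrix (Fin a) (Fin b) F) : Matrix (Fin (a / m)) (Fin (b / p)) F :=
  ∑ k, ∑ l, t k l • block hm hp X k l

variable (F) in
/-- What has to be chosen to set up an FCSA+FCC code: a bilinear algorithm of length `R` and
distinct field elements, namely a pole for each of the `R` subproblems and each task group,
and an evaluation point for each worker. -/
structure Setup (m p n R : ℕ) (Q : Type) (K : ℕ) where
  a : Fin R → Matrix (Fin m) (Fin p) F
  b : Fin R → Matrix (Fin p) (Fin n) F
  c : Fin R → Matrix (Fin m) (Fin n) F
  bilinear : IsBilinearAlgorithm a b c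
  pole : Fin R × Q → F
  point : Fin K → F
  distinct : Function.Injective (Sum.elim pole point)

variable {LA LB α β γ m p n R K : ℕ} {S : Finset (Fin LA × Fin LB)} {Q : Type} [Fintype Q]

/-- The `h`-th of the consecutive parts of size `ρ` into which the `R` subproblems are split. -/
def part (R ρ : ℕ) (h : Fin (R / ρ)) : Finset (Fin R) :=
  Finset.univ.filter fun r => r.val / ρ = h.val

/-- `Θ_h(z)`. -/
def theta (D : Setup F m p n R Q K) (T : TaskAssignment S Q) (ρ : ℕ) (h : Fin (R / ρ))
    (z : F) : F :=
  ∏ r ∈ part R ρ h, ∏ q, (z - D.pole (r, q)) ^ T.size q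

/-- The encoding function of source `A` for part `h`:
`Θ_h(z) ∑_i ∑_{r in part h} A_i^r / ∏_q (z - f_{r,q}) ^ P^{A,q}_i`. -/
def encPartA (D : Setup F m p n R Q K) {T : TaskAssignment S Q} (P : PowerAssignment T)
    (hm : m ∣ α) (hp : p ∣ β) (ρ : ℕ) (h : Fin (R / ρ))
    (A : Fin LA → Matrix (Fin α) (Fin β) F) (z : F) : Matrix (Fin (α / m)) (Fin (β / p)) F :=
  theta D T ρ h z • ∑ i ∈ activeA S, ∑ r ∈ part R ρ h,
    (∏ q, (z - D.pole (r, q)) ^ P.powA q i)⁻¹ • mixBlocks hm hp (D.a r) (A i)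

/-- The encoding function of source `B` for part `h`:
`∑_j ∑_{r in part h} B_j^r / ∏_q (z - f_{r,q}) ^ P^{B,q}_j`. -/
def encPartB (D : Setup F m p n R Q K) {T : TaskAssignment S Q} (P : PowerAssignment T)
    (hp : p ∣ β) (hn : n ∣ γ) (ρ : ℕ) (h : Fin (R / ρ))
    (B : Fin LB → Matrix (Fin β) (Fin γ) F) (z : F) : Matrix (Fin (β / p)) (Fin (γ / n)) F :=
  ∑ j ∈ activeB S, ∑ r ∈ part R ρ h,
    (∏ q, (z - D.pole (r, q)) ^ P.powB q j)⁻¹ • mixBlocks hp hn (D.b r) (B j)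

/-- The FCSA+FCC code with a given decoder. Worker `k` receives the `R / ρ` matrices `A^h(x_k)`
next to each other and the `R / ρ` matrices `B^h(x_k)` on top of each other. -/
def fcsaCode (D : Setup F m p n R Q K) {T : TaskAssignment S Q} (P : PowerAssignment T)
    (hm : m ∣ α) (hp : p ∣ β) (hn : n ∣ γ) (ρ : ℕ)
    (dec : ∀ W : Finset (Fin K), ({k // k ∈ W} → Matrix (Fin (α / m)) (Fin (γ / n)) F) →
      {s // s ∈ S} → Matrix (Fin α) (Fin γ) F) : Code F α β γ S K where
  rows _ := α / m
  inner _ := R / ρ * (β / p)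
  cols _ := γ / n
  encA k A := Matrix.of fun u v =>
    encPartA D P hm hp ρ (finProdFinEquiv.symm v).1 A (D.point k) u (finProdFinEquiv.symm v).2
  encB k B := Matrix.of fun v w =>
    encPartB D P hp hn ρ (finProdFinEquiv.symm v).1 B (D.point k) (finProdFinEquiv.symm v).2 w
  dec := dec

end FCSA

/-- `(R + ρ)|S| - min d^A - min d^B + 1`, as an integer. -/
noncomputable def type1Threshold {LA LB : ℕ} (S : Finset (Fin LA × Fin LB)) (R ρ : ℕ) : ℤ :=
  ((R : ℤ) + ρ) * S.card - minDegA S - minDegB S + 1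

/-- `log² x · log log x`, with the last factor replaced by `1` for small `x`, where `log log x`
is smaller than `1` or undefined. -/
noncomputable def logFactor (x : ℝ) : ℝ :=
  Real.log x ^ 2 * max 1 (Real.log (Real.log x))

end VCDBMM

/-!
# Decoding type-1 codes for batch matrix multiplication

Fix an entry `(u, v)` of the responses and put `G = ∏ (X - f_{r,q})`, the product over all poles.
For the type-1 tasks every pole of `B^h`, and every pole of the sum in `A^h`, is simple, and
clearing denominators turns the answer `Y(z)` into a polynomial: `responsePoly` takes the value
`G(z) Y(z)` at every `z` that is not a pole. The term of `A_i^r` and `B_j^r'` comes with all factors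
of `Θ_h`, of degree `ρ|S|`, and of `G`, of degree `R|S|`, except for those that cancel against its
denominators, of degrees `d^A_i` and `d^B_j`. So the degree is less than `R^{T1}`
(`degree_responsePoly_lt`). At the pole `f_{r,q}` all but one summand vanish, and what remains is
the entry of `A_i^r B_j^r`, where `q = (i, j)`, times a nonzero constant (`eval_responsePoly_pole`).
Hence `R^{T1}` responses determine the polynomial by Lagrange interpolation, its values at the poles
give all the `A_i^r B_j^r` (`mixBlocks_mul_eq_sum`), and the bilinear algorithm assembles the blocks
of `A_i B_j` from these (`mul_apply_eq_sum_mixBlocks`).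

The interpolation formula, read as a map from the responses to the values at the poles, is a
diagonal matrix times a Cauchy matrix `(1 / (f_t - x_k))` times a diagonal matrix. It is therefore
enough to multiply a vector by a Cauchy matrix in `O(N log² N log log N)` operations
(`reaches_cauchy`). A sum `∑ v_k / (X - x_k)` is brought over the common denominator along a binary
tree, and the numerator is evaluated at the poles along another one, with division by Barrett's
method. In both trees one factor of each polynomial product depends on the points only, so it counts
as a constant, and the whole computation is linear in the inputs. The products are found by the
method of Schönhage and Strassen (`reaches_coeffs_mul`). It works over every field: when the
characteristic is not `3`, after adjoining a primitive cube root of unity and splitting lengths by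
powers of `3`; in characteristic `3`, after adjoining a square root of `-1` and splitting by powers
of `2`.

Programs are counted by `Reaches A T S c`: starting from the elements of `S` of a module, those
of `T` are obtained with `c` linear combinations `a • u + b • v` with coefficients in `A`.
`Reaches.computableWithin` turns such a count into a straight-line program.

The recovery threshold refers to the decoders. Those constructed here return zero when fewer than
`R^{T1}` workers have responded, and zero is not the product of suitable matrix units.
-/

namespace VCDBMM

/-! ### Linear computations -/

section Reaches

variable {R M : Type*} [Semiring R] [AddCommMonoid M] [Module R M]

/-- `Reaches A T S c`: starting from the elements of `S` (and `0`), all elements of `T` can be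
computed with at most `c` operations `u, v ↦ a • u + b • v`, where the scalars `a` and `b` belong
to `A`. Intermediate results may be reused. For `M = X → F` this is the complexity of computing a
family of functions from other functions by linear instructions. -/
inductive Reaches (A : Set R) (T : Set M) : Set M → ℕ → Prop
  | done {S : Set M} {c : ℕ} : T ⊆ insert 0 S → Reaches A T S c
  | step {S : Set M} {c : ℕ} {a b : R} {u v : M} : a ∈ A → b ∈ A → u ∈ insert 0 S →
      v ∈ insert 0 S → Reaches A T (insert (a • u + b • v) S) c → Reaches A T S (c + 1)

namespace Reaches

variable {A : Set R} {S S' T T' U : Set M} {c c' : ℕ}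

theorem mono_cost (h : Reaches A T S c) (hc : c ≤ c') : Reaches A T S c' := by
  induction h generalizing c' with
  | done h => exact done h
  | step ha hb hu hv _ ih =>
    obtain ⟨d, rfl⟩ : ∃ d, c' = d + 1 := ⟨c' - 1, by omega⟩
    exact step ha hb hu hv (ih (by omega))

theorem mono_src (h : Reaches A T S c) (hS : S ⊆ insert 0 S') : Reaches A T S' c := by
  induction h generalizing S' with
  | done h =>
    refine done (h.trans ?_)
    exact Set.insert_subset (Set.mem_insert _ _) hS
  | step ha hb hu hv _ ih =>
    have h0 := Set.insert_subset (Set.mem_insert _ _) hS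
    refine step ha hb (h0 hu) (h0 hv) (ih ?_)
    rw [Set.insert_comm]
    exact Set.insert_subset_insert hS

theorem mono_tgt (h : Reaches A T S c) (hT : T' ⊆ insert 0 T) : Reaches A T' S c := by
  induction h with
  | done h =>
    exact done (hT.trans (Set.insert_subset (Set.mem_insert _ _) h))
  | step ha hb hu hv _ ih => exact step ha hb hu hv ih

theorem of_eq (h : Reaches A T S c) (hT : T' = T) : Reaches A T' S c := hT ▸ h

theorem of_subset (h : T ⊆ insert 0 S) : Reaches A T S c := done h

/-- Whatever has been computed stays available. -/
theorem trans_union (h : Reaches A T S c) (h' : Reaches A U (S ∪ T) c') :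
    Reaches A U S (c + c') := by
  induction h with
  | done h =>
    refine mono_cost (h'.mono_src ?_) (Nat.le_add_left _ _)
    exact Set.union_subset (Set.subset_insert _ _) h
  | step ha hb hu hv _ ih =>
    rw [Nat.add_right_comm]
    refine step ha hb hu hv (ih (h'.mono_src ?_))
    exact (Set.union_subset_union_left _ (Set.subset_insert _ _)).trans (Set.subset_insert _ _)

theorem trans (h : Reaches A T S c) (h' : Reaches A U T c') : Reaches A U S (c + c') :=
  h.trans_union (h'.mono_src (Set.subset_union_right.trans (Set.subset_insert _ _)))

theorem keep (h : Reaches A T S c) : Reaches A (S ∪ T) S c := by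
  simpa using h.trans_union (c' := 0) (of_subset (Set.subset_insert _ _))

theorem union (h : Reaches A T S c) (h' : Reaches A T' S c') :
    Reaches A (T ∪ T') S (c + c') := by
  refine h.trans_union (mono_tgt (h'.mono_src (S' := S ∪ T) ?_).keep ?_)
  · exact Set.subset_union_left.trans (Set.subset_insert _ _)
  · refine Set.Subset.trans ?_ (Set.subset_insert _ _)
    exact Set.union_subset_union_left _ Set.subset_union_right

theorem biUnion {ι : Type*} (s : Finset ι) (T : ι → Set M) (d : ι → ℕ)
    (h : ∀ i ∈ s, Reaches A (T i) S (d i)) : Reaches A (⋃ i ∈ s, T i) S (∑ i ∈ s, d i) := by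
  classical
  induction s using Finset.induction_on with
  | empty => exact of_subset (by simp)
  | insert i s hi ih =>
    rw [Finset.sum_insert hi, Finset.set_biUnion_insert]
    exact (h i (Finset.mem_insert_self _ _)).union
      (ih fun j hj => h j (Finset.mem_insert_of_mem hj))

theorem biUnion_const {ι : Type*} (s : Finset ι) (T : ι → Set M) {d : ℕ}
    (h : ∀ i ∈ s, Reaches A (T i) S d) : Reaches A (⋃ i ∈ s, T i) S (s.card * d) := by
  simpa using biUnion s T (fun _ => d) h

theorem image {ι : Type*} (s : Finset ι) (t : ι → M) {d : ℕ}
    (h : ∀ i ∈ s, Reaches A {t i} S d) : Reaches A (t '' s) S (s.card * d) := by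
  refine (biUnion_const s (fun i => {t i}) h).mono_tgt ?_
  rintro _ ⟨i, hi, rfl⟩
  exact Set.mem_insert_of_mem _ (by simpa using ⟨i, hi, rfl⟩)

theorem single {a b : R} {u v : M} (ha : a ∈ A) (hb : b ∈ A) (hu : u ∈ insert 0 S)
    (hv : v ∈ insert 0 S) : Reaches A {a • u + b • v} S 1 :=
  step ha hb hu hv (done (by simp))

theorem smul {a : R} {u : M} (ha : a ∈ A) (hu : u ∈ insert 0 S) : Reaches A {a • u} S 1 := by
  simpa using single ha ha hu (Set.mem_insert 0 S)

theorem sum {ι : Type*} (s : Finset ι) (a : ι → R) (u : ι → M) (h1 : (1 : R) ∈ A)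
    (ha : ∀ i ∈ s, a i ∈ A) (hu : ∀ i ∈ s, u i ∈ insert 0 S) :
    Reaches A {∑ i ∈ s, a i • u i} S s.card := by
  classical
  induction s using Finset.induction_on with
  | empty => exact of_subset (by simp)
  | insert i s hi ih =>
    rw [Finset.sum_insert hi, Finset.card_insert_of_notMem hi]
    refine (ih (fun j hj => ha j (Finset.mem_insert_of_mem hj))
      (fun j hj => hu j (Finset.mem_insert_of_mem hj))).trans_union ?_
    have := single (A := A) (S := S ∪ {∑ i ∈ s, a i • u i}) (ha i (Finset.mem_insert_self _ _)) h1
      (u := u i) (v := ∑ i ∈ s, a i • u i) ?_ (by simp)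
    · simpa using this
    · exact Set.insert_subset_insert Set.subset_union_left (hu i (Finset.mem_insert_self _ _))

/-- Replaces a computation over `R` by a computation over `R'`, where every element of the module
`M` is represented by a set of elements (its coordinates) of the module `M'`. -/
theorem translate {R' M' : Type*} [Semiring R'] [AddCommMonoid M'] [Module R' M'] {A' : Set R'}
    (co : M → Set M') {κ : ℕ} (h0 : co 0 ⊆ {0})
    (hop : ∀ a ∈ A, ∀ b ∈ A, ∀ u v : M, Reaches A' (co (a • u + b • v)) (co u ∪ co v) κ)
    (h : Reaches A T S c) : Reaches A' (⋃ u ∈ T, co u) (⋃ u ∈ S, co u) (c * κ) := by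
  have key : ∀ S : Set M, ∀ u ∈ insert 0 S, co u ⊆ insert 0 (⋃ u ∈ S, co u) := by
    rintro S u (rfl | hu)
    · exact h0.trans (by simp)
    · exact (Set.subset_biUnion_of_mem (u := co) hu).trans (Set.subset_insert _ _)
  induction h with
  | done h => exact of_subset (Set.iUnion₂_subset fun u hu => key _ _ (h hu))
  | step ha hb hu hv _ ih =>
    rw [Nat.succ_mul, Nat.add_comm]
    refine ((hop _ ha _ hb _ _).mono_src
      (Set.union_subset (key _ _ hu) (key _ _ hv))).trans_union (ih.mono_src ?_)
    rw [Set.biUnion_insert, Set.union_comm]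
    exact Set.subset_insert _ _

end Reaches

end Reaches

/-! ### Linear computations as straight-line programs -/

section Program

variable {F ι κ : Type*} [Field F]

theorem runProgram_append (x : ι → F) (P Q : List (Instr F ι)) (regs : List F) :
    runProgram x (P ++ Q) regs = runProgram x Q (runProgram x P regs) := by
  induction P generalizing regs with
  | nil => rfl
  | cons s P ih => exact ih _

theorem length_runProgram (x : ι → F) (P : List (Instr F ι)) (regs : List F) :
    (runProgram x P regs).length = regs.length + P.length := by
  induction P generalizing regs with
  | nil => rfl
  | cons s P ih =>
    rw [runProgram, ih]
    simp [Nat.add_assoc, Nat.add_comm]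

/-- After running `P`, the function `u` of the inputs is an input or the result of one of the
instructions of `P`. -/
def Stored (P : List (Instr F ι)) (u : (ι → F) → F) : Prop :=
  (∃ i, ∀ x, u x = x i) ∨ ∃ t < P.length, ∀ x, u x = (runProgram x P []).getD t 0

theorem Stored.exists_operand {P : List (Instr F ι)} {u : (ι → F) → F} (h : Stored P u) :
    ∃ o : ι ⊕ ℕ, ∀ x, u x = operandValue x (runProgram x P []) o := by
  rcases h with ⟨i, h⟩ | ⟨t, _, h⟩
  · exact ⟨Sum.inl i, h⟩
  · exact ⟨Sum.inr t, h⟩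

theorem Stored.append {P : List (Instr F ι)} {u : (ι → F) → F} (h : Stored P u) (s : Instr F ι) :
    Stored (P ++ [s]) u := by
  rcases h with ⟨i, h⟩ | ⟨t, ht, h⟩
  · exact Or.inl ⟨i, h⟩
  · refine Or.inr ⟨t, by simp; omega, fun x => ?_⟩
    rw [h x, runProgram_append]
    simp only [runProgram]
    rw [List.getD_append]
    simpa [length_runProgram] using ht

theorem stored_last (P : List (Instr F ι)) (s : Instr F ι) :
    Stored (P ++ [s]) fun x => s.value x (runProgram x P []) := by
  refine Or.inr ⟨P.length, by simp, fun x => ?_⟩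
  rw [runProgram_append]
  simp only [runProgram]
  rw [List.getD_append_right _ _ _ _ (by simp [length_runProgram])]
  simp [length_runProgram]

/-- A linear combination of two stored functions takes five more instructions. -/
theorem Stored.exists_linearComb {P : List (Instr F ι)} {u v : (ι → F) → F} (hu : Stored P u)
    (hv : Stored P v) (a b : F) :
    ∃ Q : List (Instr F ι), Q.length = P.length + 5 ∧ (∀ w, Stored P w → Stored Q w) ∧
      Stored Q (a • u + b • v) := by
  have const : ∀ (P : List (Instr F ι)) (c : F), Stored (P ++ [Instr.const c]) fun _ => c :=
    fun P c => stored_last P (Instr.const c)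
  have mul : ∀ (P : List (Instr F ι)) {f g : (ι → F) → F}, Stored P f → Stored P g →
      ∃ s, Stored (P ++ [s]) (f * g) := by
    intro P f g hf hg
    obtain ⟨o, ho⟩ := hf.exists_operand
    obtain ⟨o', ho'⟩ := hg.exists_operand
    refine ⟨Instr.mul o o', ?_⟩
    convert stored_last P (Instr.mul o o') using 1
    funext x
    simp [Instr.value, ho x, ho' x]
  have add : ∀ (P : List (Instr F ι)) {f g : (ι → F) → F}, Stored P f → Stored P g →
      ∃ s, Stored (P ++ [s]) (f + g) := by
    intro P f g hf hg
    obtain ⟨o, ho⟩ := hf.exists_operand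
    obtain ⟨o', ho'⟩ := hg.exists_operand
    refine ⟨Instr.add o o', ?_⟩
    convert stored_last P (Instr.add o o') using 1
    funext x
    simp [Instr.value, ho x, ho' x]
  obtain ⟨s, hs⟩ := mul _ (const P a) (hu.append _)
  obtain ⟨s', hs'⟩ := mul _ (const (P ++ [Instr.const a] ++ [s]) b)
    (((hv.append _).append _).append _)
  obtain ⟨s'', hs''⟩ := add _ ((hs.append _).append _) hs'
  exact ⟨_, by simp, fun w hw => ((((hw.append _).append _).append _).append _).append _, hs''⟩

theorem Reaches.exists_program {T S : Set ((ι → F) → F)} {c : ℕ}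
    (h : Reaches (Set.univ : Set F) T S c) (P : List (Instr F ι))
    (hP : ∀ u ∈ insert 0 S, Stored P u) :
    ∃ Q : List (Instr F ι), Q.length ≤ P.length + 5 * c ∧ ∀ u ∈ T, Stored Q u := by
  induction h generalizing P with
  | done h => exact ⟨P, by omega, fun u hu => hP u (h hu)⟩
  | @step S c a b u v _ _ hu hv _ ih =>
    obtain ⟨Q, hQ, hQP, hQw⟩ := (hP u hu).exists_linearComb (hP v hv) a b
    obtain ⟨Q', hQ', h'⟩ := ih Q (by
      intro w hw
      rw [Set.insert_comm] at hw
      rcases hw with rfl | hw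
      · exact hQw
      · exact hQP w (hP w hw))
    exact ⟨Q', by omega, h'⟩

/-- A map all of whose components can be computed linearly from the inputs is computed by a
straight-line program of proportional length. -/
theorem Reaches.computableWithin {f : (ι → F) → κ → F} {c : ℕ} {r : ℝ}
    (h : Reaches (Set.univ : Set F) (Set.range fun k x => f x k) (Set.range fun i x => x i) c)
    (hr : (5 * c + 1 : ℝ) ≤ r) : ComputableWithin r f := by
  obtain ⟨Q, hQ, hT⟩ := h.exists_program [Instr.const 0] (by
    rintro u (rfl | ⟨i, rfl⟩)
    · exact stored_last [] (Instr.const 0)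
    · exact Or.inl ⟨i, fun _ => rfl⟩)
  choose out hout using fun k => (hT _ ⟨k, rfl⟩).exists_operand
  refine ⟨Q, le_trans ?_ hr, out, fun x k => hout k x⟩
  have : (Q.length : ℝ) ≤ ((1 + 5 * c : ℕ) : ℝ) := by exact_mod_cast hQ
  push_cast at this
  linarith

end Program

/-! ### The fast Fourier transform -/

section Fourier

variable {R M : Type*} [CommRing R] [AddCommGroup M] [Module R M]

theorem sum_range_mul_eq {M : Type*} [AddCommMonoid M] (s n : ℕ) (f : ℕ → M) :
    ∑ i ∈ Finset.range (s * n), f i =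
      ∑ i ∈ Finset.range n, ∑ j ∈ Finset.range s, f (s * i + j) := by
  induction n with
  | zero => simp
  | succ n ih => rw [Nat.mul_succ, Finset.sum_range_add, ih, Finset.sum_range_succ]

/-- The value at `ω ^ t` of the polynomial with coefficients `a 0, …, a (m - 1)`. -/
def dft (ω : R) (m : ℕ) (a : ℕ → M) (t : ℕ) : M :=
  ∑ i ∈ Finset.range m, ω ^ (t * i) • a i

theorem dft_periodic {ω : R} {m : ℕ} (hω : ω ^ m = 1) (a : ℕ → M) (t : ℕ) :
    dft ω m a t = dft ω m a (t % m) := by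
  refine Finset.sum_congr rfl fun i _ => ?_
  congr 1
  conv_lhs => rw [← Nat.mod_add_div t m]
  rw [Nat.add_mul, pow_add, mul_assoc, pow_mul ω m, hω, one_pow, mul_one]

theorem range_dft {ω : R} {m : ℕ} (hm : 0 < m) (hω : ω ^ m = 1) (a : ℕ → M) :
    Set.range (dft ω m a) = dft ω m a '' (Finset.range m : Set ℕ) := by
  refine Set.Subset.antisymm ?_ (Set.image_subset_range _ _)
  rintro _ ⟨t, rfl⟩
  exact ⟨t % m, by simpa using Nat.mod_lt _ hm, (dft_periodic hω a t).symm⟩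

/-- Splitting the coefficients by their index modulo `s`. -/
theorem dft_succ (ω : R) (s k : ℕ) (a : ℕ → M) (t : ℕ) :
    dft ω (s ^ (k + 1)) a t = ∑ j ∈ Finset.range s,
      ω ^ (t * j) • dft (ω ^ s) (s ^ k) (fun i => a (s * i + j)) t := by
  rw [dft, pow_succ', sum_range_mul_eq, Finset.sum_comm]
  refine Finset.sum_congr rfl fun j _ => ?_
  rw [dft, Finset.smul_sum]
  refine Finset.sum_congr rfl fun i _ => ?_
  rw [smul_smul, ← pow_mul, ← pow_add]
  congr 2
  ring

/-- The fast Fourier transform of length `s ^ k`. -/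
theorem reaches_dft {A : Set R} {s : ℕ} (hs : 0 < s) (k : ℕ) (ω : R) (a : ℕ → M)
    (hω : ω ^ s ^ k = 1) (hA : ∀ e, ω ^ e ∈ A) :
    Reaches A (Set.range (dft ω (s ^ k) a)) (a '' (Finset.range (s ^ k) : Set ℕ))
      (k * s ^ (k + 1)) := by
  induction k generalizing ω a with
  | zero =>
    refine Reaches.of_subset ?_
    rintro _ ⟨t, rfl⟩
    exact Set.mem_insert_of_mem _ ⟨0, by simp, by simp [dft]⟩
  | succ k ih =>
    have hω' : (ω ^ s) ^ s ^ k = 1 := by rw [← pow_mul, ← pow_succ', hω]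
    have hstep : Reaches A
        (⋃ j ∈ Finset.range s, Set.range (dft (ω ^ s) (s ^ k) fun i => a (s * i + j)))
        (a '' (Finset.range (s ^ (k + 1)) : Set ℕ)) (s * (k * s ^ (k + 1))) := by
      have := Reaches.biUnion_const (A := A) (S := a '' (Finset.range (s ^ (k + 1)) : Set ℕ))
        (d := k * s ^ (k + 1)) (Finset.range s)
        (fun j => Set.range (dft (ω ^ s) (s ^ k) fun i => a (s * i + j))) (by
          intro j hj
          refine (ih (ω ^ s) (fun i => a (s * i + j)) hω'
            (fun e => by rw [← pow_mul]; exact hA _)).mono_src ?_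
          rintro _ ⟨i, hi, rfl⟩
          refine Set.mem_insert_of_mem _ ⟨s * i + j, ?_, rfl⟩
          simp only [Finset.coe_range, Set.mem_Iio, Finset.mem_range] at hi hj ⊢
          calc s * i + j < s * i + s := by omega
            _ = s * (i + 1) := by ring
            _ ≤ s * s ^ k := Nat.mul_le_mul_left _ hi
            _ = s ^ (k + 1) := (pow_succ' _ _).symm)
      simpa using this
    rw [range_dft (pow_pos hs _) hω]
    refine (hstep.trans (Reaches.image _ _ (d := s) fun t _ => ?_)).mono_cost (le_of_eq ?_)
    · rw [dft_succ]
      simpa using Reaches.sum (A := A) (Finset.range s) (fun j => ω ^ (t * j))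
        (fun j => dft (ω ^ s) (s ^ k) (fun i => a (s * i + j)) t)
        (by simpa using hA 0) (fun j _ => hA _) (fun j hj => Set.mem_insert_of_mem _
          (Set.mem_biUnion (Finset.mem_coe.2 hj) (Set.mem_range_self t)))
    · rw [Finset.card_range]
      ring

/-- Orthogonality of the powers of a principal root of unity of order `s ^ (k + 1)`. -/
theorem sum_pow_eq_zero {s : ℕ} {θ : R} (hθs : θ ^ s = 1)
    (hθ : ∀ i, ¬ s ∣ i → ∑ r ∈ Finset.range s, θ ^ (i * r) = 0) (k : ℕ) (ω : R)
    (hω : ω ^ s ^ k = θ) {d : ℕ} (hd : ¬ s ^ (k + 1) ∣ d) :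
    ∑ t ∈ Finset.range (s ^ (k + 1)), ω ^ (d * t) = 0 := by
  induction k generalizing ω d with
  | zero =>
    simp only [pow_zero, pow_one, zero_add] at hω hd ⊢
    rw [hω]
    exact hθ d hd
  | succ k ih =>
    by_cases hsd : s ∣ d
    · obtain ⟨e, rfl⟩ := hsd
      rw [pow_succ s (k + 1), sum_range_mul_eq]
      refine Finset.sum_eq_zero fun j _ => ?_
      have hexp : ∀ i, ω ^ (s * e * (s ^ (k + 1) * j + i)) = (ω ^ s) ^ (e * i) := by
        intro i
        have h1 : ω ^ s ^ (k + 1 + 1) = 1 := by rw [pow_succ, pow_mul, hω, hθs]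
        calc ω ^ (s * e * (s ^ (k + 1) * j + i))
            = (ω ^ s ^ (k + 1 + 1)) ^ (e * j) * (ω ^ s) ^ (e * i) := by
              rw [← pow_mul, ← pow_mul, ← pow_add]
              congr 1
              ring
          _ = (ω ^ s) ^ (e * i) := by rw [h1, one_pow, one_mul]
      simp only [hexp]
      refine ih (ω ^ s) (by rw [← pow_mul, ← pow_succ', hω]) fun h => hd ?_
      rw [pow_succ']
      exact Nat.mul_dvd_mul_left s h
    · rw [pow_succ' s (k + 1), mul_comm, sum_range_mul_eq, Finset.sum_comm]
      refine Finset.sum_eq_zero fun i _ => ?_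
      have hexp : ∀ j, ω ^ (d * (s ^ (k + 1) * j + i)) = ω ^ (d * i) * θ ^ (d * j) := by
        intro j
        rw [← hω, ← pow_mul, ← pow_add]
        congr 1
        ring
      simp only [hexp, ← Finset.mul_sum]
      rw [hθ d hsd, mul_zero]

/-- The inverse Fourier transform. -/
theorem dft_dft {ω ω' : R} {m : ℕ} (hω : ω ^ m = 1) (hωω' : ω * ω' = 1)
    (horth : ∀ d, ¬ m ∣ d → ∑ t ∈ Finset.range m, ω ^ (d * t) = 0) (a : ℕ → M) {j : ℕ}
    (hj : j < m) : dft ω' m (dft ω m a) j = (m : R) • a j := by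
  have hω' : ω' = ω ^ (m - 1) := by
    calc ω' = ω ^ m * ω' := by rw [hω, one_mul]
      _ = ω ^ (m - 1) * (ω * ω') := by
        rw [← mul_assoc, ← pow_succ, Nat.sub_add_cancel (by omega)]
      _ = ω ^ (m - 1) := by rw [hωω', mul_one]
  have hsum : ∀ i ∈ Finset.range m, (∑ t ∈ Finset.range m, ω ^ (((m - 1) * j + i) * t)) • a i =
      if i = j then (m : R) • a j else 0 := by
    intro i hi
    rw [Finset.mem_range] at hi
    split_ifs with hij
    · subst hij
      congr 1
      have : ∀ t, ω ^ (((m - 1) * i + i) * t) = 1 := by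
        intro t
        have h1 : (m - 1) * i + i = m * i := by
          rw [← Nat.succ_mul, Nat.succ_eq_add_one, Nat.sub_add_cancel (by omega)]
        rw [h1, mul_assoc, pow_mul, hω, one_pow]
      simp [this]
    · rw [horth, zero_smul]
      intro hdvd
      apply hij
      obtain ⟨e, he⟩ := hdvd
      have h1 : (m : ℤ) ∣ (i : ℤ) - j := by
        refine ⟨(e : ℤ) - j, ?_⟩
        have h2 : (((m - 1 : ℕ) : ℤ)) = (m : ℤ) - 1 := by
          rw [Nat.cast_sub (by omega), Nat.cast_one]
        have h3 : (((m - 1 : ℕ) : ℤ)) * j + i = m * e := by exact_mod_cast he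
        rw [h2] at h3
        linear_combination h3
      have h4 := Int.eq_zero_of_abs_lt_dvd h1 (by rw [abs_lt]; constructor <;> omega)
      omega
  calc dft ω' m (dft ω m a) j
      = ∑ t ∈ Finset.range m, ∑ i ∈ Finset.range m, ω ^ (((m - 1) * j + i) * t) • a i := by
        refine Finset.sum_congr rfl fun t _ => ?_
        rw [dft, Finset.smul_sum]
        refine Finset.sum_congr rfl fun i _ => ?_
        rw [smul_smul, hω', ← pow_mul, ← pow_add]
        congr 2
        ring
    _ = ∑ i ∈ Finset.range m, if i = j then (m : R) • a j else 0 := by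
        rw [Finset.sum_comm]
        refine Finset.sum_congr rfl fun i hi => ?_
        rw [← hsum i hi, Finset.sum_smul]
    _ = (m : R) • a j := by simp [hj]

/-- The coefficient of `y ^ j` in the product of `∑ a i * y ^ i` and `∑ b i * y ^ i`
(`i < m`), reduced by the rule `y ^ m = ξ`. -/
def twistedConv (m : ℕ) (ξ : R) (a b : ℕ → R) (j : ℕ) : R :=
  ∑ p ∈ Finset.range m ×ˢ Finset.range m,
    if p.1 + p.2 = j then a p.1 * b p.2
    else if p.1 + p.2 = j + m then ξ * (a p.1 * b p.2) else 0

theorem map_twistedConv {R' : Type*} [CommRing R'] (φ : R →+* R') (m : ℕ) (ξ : R) (a b : ℕ → R)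
    (j : ℕ) : φ (twistedConv m ξ a b j) =
      twistedConv m (φ ξ) (fun i => φ (a i)) (fun i => φ (b i)) j := by
  simp only [twistedConv, map_sum]
  refine Finset.sum_congr rfl fun p _ => ?_
  split_ifs <;> simp

theorem sum_mul_sum_eq_twistedConv {m : ℕ} {ξ y : R} (hy : y ^ m = ξ) (a b : ℕ → R) :
    (∑ i ∈ Finset.range m, y ^ i * a i) * (∑ i ∈ Finset.range m, y ^ i * b i) =
      ∑ j ∈ Finset.range m, y ^ j * twistedConv m ξ a b j := by
  rw [Finset.sum_mul_sum, ← Finset.sum_product']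
  simp only [twistedConv, Finset.mul_sum]
  rw [Finset.sum_comm]
  refine Finset.sum_congr rfl fun p hp => ?_
  rw [Finset.mem_product, Finset.mem_range, Finset.mem_range] at hp
  obtain ⟨h1, h2⟩ := hp
  by_cases h : p.1 + p.2 < m
  · rw [Finset.sum_eq_single (p.1 + p.2)]
    · rw [if_pos rfl, pow_add]
      ring
    · intro j hj hne
      rw [if_neg (by omega), if_neg (by rw [Finset.mem_range] at hj; omega), mul_zero]
    · intro hj
      exact absurd (Finset.mem_range.2 h) hj
  · rw [Finset.sum_eq_single (p.1 + p.2 - m)]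
    · rw [if_neg (by omega), if_pos (by omega), ← hy]
      have : y ^ p.1 * y ^ p.2 = y ^ (p.1 + p.2 - m) * y ^ m := by
        rw [← pow_add, ← pow_add]
        congr 1
        omega
      linear_combination (a p.1 * b p.2) * this
    · intro j hj hne
      rw [Finset.mem_range] at hj
      rw [if_neg (by omega), if_neg (by omega), mul_zero]
    · intro hj
      exact absurd (Finset.mem_range.2 (by omega)) hj

end Fourier

/-! ### The rings `E[x] / (x ^ n - ξ)` -/

section TwistedRing

open Polynomial

variable {E : Type*} [CommRing E]

/-- The ring `E[x] / (x ^ n - ξ)`. -/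
abbrev TwistedRing (E : Type*) [CommRing E] (n : ℕ) (ξ : E) : Type _ :=
  AdjoinRoot (X ^ n - C ξ : E[X])

namespace TwistedRing

variable {n : ℕ} {ξ : E}

theorem monic_modulus (n : ℕ) [NeZero n] (ξ : E) : (X ^ n - C ξ : E[X]).Monic :=
  monic_X_pow_sub_C ξ (NeZero.ne n)

/-- The quotient map. -/
noncomputable abbrev mk (n : ℕ) (ξ : E) : E[X] →+* TwistedRing E n ξ := AdjoinRoot.mk _

/-- The image of the variable `x`. -/
noncomputable abbrev gen (n : ℕ) (ξ : E) : TwistedRing E n ξ := AdjoinRoot.root _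

theorem gen_pow : gen n ξ ^ n = AdjoinRoot.of _ ξ := by
  have : mk n ξ (X ^ n - C ξ) = 0 := AdjoinRoot.mk_self
  rw [map_sub, map_pow, AdjoinRoot.mk_X, AdjoinRoot.mk_C, sub_eq_zero] at this
  exact this

variable [NeZero n]

/-- The representative of degree less than `n`. -/
noncomputable def rep : TwistedRing E n ξ →ₗ[E] E[X] :=
  AdjoinRoot.modByMonicHom (monic_modulus n ξ)

theorem mk_rep (u : TwistedRing E n ξ) : mk n ξ (rep u) = u :=
  AdjoinRoot.mk_leftInverse (monic_modulus n ξ) u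

variable [Nontrivial E]

theorem degree_modulus : (X ^ n - C ξ : E[X]).degree = n :=
  degree_X_pow_sub_C (Nat.pos_of_ne_zero (NeZero.ne n)) ξ

theorem rep_mk_of_degree_lt {p : E[X]} (hp : p.degree < n) : rep (mk n ξ p) = p := by
  rw [rep, AdjoinRoot.modByMonicHom_mk, modByMonic_eq_self_iff (monic_modulus n ξ),
    degree_modulus]
  exact hp

theorem degree_rep_lt (u : TwistedRing E n ξ) : (rep u).degree < n := by
  rw [← mk_rep u, rep, AdjoinRoot.modByMonicHom_mk]
  refine (degree_modByMonic_lt _ (monic_modulus n ξ)).trans_eq degree_modulus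

theorem coeff_rep_eq_zero (u : TwistedRing E n ξ) {i : ℕ} (hi : n ≤ i) : (rep u).coeff i = 0 :=
  coeff_eq_zero_of_degree_lt ((degree_rep_lt u).trans_le (by exact_mod_cast hi))

/-- Below degree `2 * n`, reducing by the rule `x ^ n = ξ` adds `ξ` times the upper half of the
coefficients to the lower half. -/
theorem coeff_rep_mk {p : E[X]} (hp : p.degree < (2 * n : ℕ)) {i : ℕ} (hi : i < n) :
    (rep (mk n ξ p)).coeff i = p.coeff i + ξ * p.coeff (n + i) := by
  set q : E[X] := ∑ i ∈ Finset.range n, C (p.coeff i + ξ * p.coeff (n + i)) * X ^ i with hq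
  have hmk : mk n ξ p = mk n ξ q := by
    have h2 : p = ∑ i ∈ Finset.range (n + n), C (p.coeff i) * X ^ i := by
      by_cases h0 : p = 0
      · simp [h0]
      · have := p.as_sum_range' (n + n) ((natDegree_lt_iff_degree_lt h0).2 (by
          rw [← two_mul]; exact hp))
        simpa [C_mul_X_pow_eq_monomial] using this
    rw [h2, hq, Finset.sum_range_add, ← Finset.sum_add_distrib, map_sum, map_sum]
    refine Finset.sum_congr rfl fun i _ => ?_
    simp only [map_add, map_mul, map_pow, AdjoinRoot.mk_C, AdjoinRoot.mk_X, pow_add, gen_pow]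
    ring
  have hdeg : q.degree < n := by
    rw [hq]
    refine (degree_sum_le _ _).trans_lt ((Finset.sup_lt_iff (WithBot.bot_lt_coe n)).2 ?_)
    intro i hi
    refine (degree_C_mul_X_pow_le _ _).trans_lt ?_
    exact WithBot.coe_lt_coe.2 (Finset.mem_range.1 hi)
  rw [hmk, rep_mk_of_degree_lt hdeg, hq, finsetSum_coeff]
  simp only [coeff_C_mul, coeff_X_pow]
  simp [hi]

/-- Multiplication by a power of `x` permutes and rescales the coefficients. -/
theorem exists_coeff_rep_gen_pow_mul (e i : ℕ) (hi : i < n) :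
    ∃ (i' : ℕ) (c : E), ∀ u : TwistedRing E n ξ,
      (rep (gen n ξ ^ e * u)).coeff i = c * (rep u).coeff i' := by
  induction e generalizing i with
  | zero => exact ⟨i, 1, fun u => by simp⟩
  | succ e ih =>
    have hx : ∀ u : TwistedRing E n ξ, (rep (gen n ξ * u)).coeff i =
        (X * rep u).coeff i + ξ * (X * rep u).coeff (n + i) := by
      intro u
      conv_lhs => rw [← mk_rep u]
      rw [gen, ← AdjoinRoot.mk_X, ← map_mul]
      refine coeff_rep_mk ?_ hi
      rw [mul_comm, degree_mul_X]
      have h1 := degree_rep_lt u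
      have h2 : ((2 * n : ℕ) : WithBot ℕ) = (n : WithBot ℕ) + n := by push_cast; ring
      have h3 : 0 < n := Nat.pos_of_ne_zero (NeZero.ne n)
      rw [degree_lt_iff_coeff_zero] at h1
      have h4 : (rep u).degree ≤ ((n - 1 : ℕ) : WithBot ℕ) :=
        (degree_le_iff_coeff_zero _ _).2 fun m hm => h1 m (by
          have : n - 1 < m := by exact_mod_cast hm
          omega)
      calc (rep u).degree + 1 ≤ ((n - 1 : ℕ) : WithBot ℕ) + 1 := by gcongr
        _ = ((n - 1 + 1 : ℕ) : WithBot ℕ) := by push_cast; rfl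
        _ < ((2 * n : ℕ) : WithBot ℕ) := by exact_mod_cast (by omega)
    cases i with
    | zero =>
      obtain ⟨i', c, h⟩ := ih (n - 1) (by omega)
      refine ⟨i', ξ * c, fun u => ?_⟩
      rw [pow_succ', mul_assoc, hx]
      have : n + 0 = (n - 1) + 1 := by omega
      rw [this, coeff_X_mul, coeff_X_mul_zero, h, zero_add, mul_assoc]
    | succ i =>
      obtain ⟨i', c, h⟩ := ih i (by omega)
      refine ⟨i', c, fun u => ?_⟩
      rw [pow_succ', mul_assoc, hx, ← add_assoc, coeff_X_mul, coeff_X_mul, h,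
        coeff_rep_eq_zero _ (Nat.le_add_right n i), mul_zero, add_zero]

end TwistedRing

/-- The coefficient functions of a family of polynomials. -/
def coeffs {Ω : Type*} (p : Ω → E[X]) : Set (Ω → E) :=
  Set.range fun (i : ℕ) x => (p x).coeff i

/-- The coefficient functions of a family of elements of `E[x] / (x ^ n - ξ)`. -/
def coords {Ω : Type*} {n : ℕ} [NeZero n] {ξ : E} (u : Ω → TwistedRing E n ξ) : Set (Ω → E) :=
  coeffs fun x => TwistedRing.rep (u x)

/-- The elements `c x ^ e` of `E[x] / (x ^ n - ξ)`. -/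
def monomials (n : ℕ) (ξ : E) : Set (TwistedRing E n ξ) :=
  {r | ∃ (c : E) (e : ℕ), r = AdjoinRoot.of _ c * TwistedRing.gen n ξ ^ e}

theorem gen_pow_mem_monomials (n : ℕ) (ξ : E) (e : ℕ) :
    TwistedRing.gen n ξ ^ e ∈ monomials n ξ := ⟨1, e, by simp⟩

/-- Only the coefficients below the degree bound have to be computed. -/
theorem Reaches.coeffs {Ω : Type*} {S : Set (Ω → E)} {p : Ω → E[X]} (n : ℕ) {d : ℕ}
    (hp : ∀ x, (p x).degree < n)
    (h : ∀ i < n, Reaches (Set.univ : Set E) {fun x => (p x).coeff i} S d) :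
    Reaches (Set.univ : Set E) (coeffs p) S (n * d) := by
  have := Reaches.image (A := (Set.univ : Set E)) (S := S) (Finset.range n)
    (fun i x => (p x).coeff i) (d := d) fun i hi => h i (Finset.mem_range.1 hi)
  rw [Finset.card_range] at this
  refine this.mono_tgt ?_
  rintro _ ⟨i, rfl⟩
  by_cases hi : i < n
  · exact Set.mem_insert_of_mem _ ⟨i, by simpa using hi, rfl⟩
  · left
    funext x
    exact coeff_eq_zero_of_degree_lt ((hp x).trans_le (by exact_mod_cast not_lt.1 hi))

variable [Nontrivial E]

/-- A linear combination with monomial coefficients of two elements of `E[x] / (x ^ n - ξ)` takes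
one operation per coefficient. -/
theorem reaches_coords_linearComb {Ω : Type*} {n : ℕ} [NeZero n] {ξ : E}
    {a b : TwistedRing E n ξ} (ha : a ∈ monomials n ξ) (hb : b ∈ monomials n ξ)
    (u v : Ω → TwistedRing E n ξ) :
    Reaches (Set.univ : Set E) (coords (a • u + b • v)) (coords u ∪ coords v) n := by
  obtain ⟨c, e, rfl⟩ := ha
  obtain ⟨d, f, rfl⟩ := hb
  have := Reaches.coeffs (S := coords u ∪ coords v)
    (p := fun x => TwistedRing.rep (((AdjoinRoot.of _ c * TwistedRing.gen n ξ ^ e) • u +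
      (AdjoinRoot.of _ d * TwistedRing.gen n ξ ^ f) • v) x)) n (d := 1)
    (fun x => TwistedRing.degree_rep_lt _) ?_
  · rwa [Nat.mul_one] at this
  intro i hi
  obtain ⟨i₁, c₁, h₁⟩ := TwistedRing.exists_coeff_rep_gen_pow_mul (ξ := ξ) e i hi
  obtain ⟨i₂, c₂, h₂⟩ := TwistedRing.exists_coeff_rep_gen_pow_mul (ξ := ξ) f i hi
  have := Reaches.single (A := (Set.univ : Set E)) (S := coords u ∪ coords v)
    (Set.mem_univ (c * c₁)) (Set.mem_univ (d * c₂))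
    (u := fun x => (TwistedRing.rep (u x)).coeff i₁)
    (v := fun x => (TwistedRing.rep (v x)).coeff i₂)
    (Set.mem_insert_of_mem _ (Or.inl ⟨i₁, rfl⟩)) (Set.mem_insert_of_mem _ (Or.inr ⟨i₂, rfl⟩))
  convert this using 2
  funext x
  have hof : ∀ (r : E) (w : TwistedRing E n ξ), AdjoinRoot.of _ r * w = r • w := by
    intro r w
    rw [Algebra.smul_def]
    rfl
  simp only [Pi.add_apply, Pi.smul_apply, smul_eq_mul, map_add, coeff_add, hof,
    smul_mul_assoc, map_smul, coeff_smul, h₁, h₂, mul_assoc]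

/-- A computation with monomial coefficients over `E[x] / (x ^ n - ξ)` is a computation over `E`
that is `n` times as long. -/
theorem Reaches.of_monomials {Ω : Type*} {n : ℕ} [NeZero n] {ξ : E}
    {S T : Set (Ω → TwistedRing E n ξ)} {c : ℕ} (h : Reaches (monomials n ξ) T S c) :
    Reaches (Set.univ : Set E) (⋃ u ∈ T, coords u) (⋃ u ∈ S, coords u) (c * n) := by
  refine h.translate coords ?_ fun a ha b hb u v => reaches_coords_linearComb ha hb u v
  rintro _ ⟨i, rfl⟩
  simp only [Set.mem_singleton_iff]
  funext x
  simp

end TwistedRing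

/-! ### Fast multiplication by a fixed element -/

section FastMul

open Polynomial

variable {E : Type*} [CommRing E]

/-- `ζ` and `ζ' = ζ⁻¹` are roots of unity such that `ζ ^ u` and `ζ' ^ u` are principal roots of
unity of order `s`, and `s` and `ζ - ζ'` are invertible. The exponent `u` makes room for a root `ζ`
of order `2 * s`: for `s = 2`, the root of order `2` is its own inverse and cannot serve as `ζ`. -/
structure IsRootPair (s u : ℕ) (ζ ζ' : E) : Prop where
  u_pos : 0 < u
  two_le : 2 ≤ s
  mul_eq : ζ * ζ' = 1
  pow_eq : ζ ^ (u * s) = 1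
  sum_eq : ∀ i, ¬ s ∣ i → ∑ r ∈ Finset.range s, (ζ ^ u) ^ (i * r) = 0
  sum_eq' : ∀ i, ¬ s ∣ i → ∑ r ∈ Finset.range s, (ζ' ^ u) ^ (i * r) = 0
  isUnit_sub : IsUnit (ζ - ζ')
  isUnit_natCast : IsUnit (s : E)

theorem IsRootPair.symm {s u : ℕ} {ζ ζ' : E} (h : IsRootPair s u ζ ζ') :
    IsRootPair s u ζ' ζ where
  u_pos := h.u_pos
  two_le := h.two_le
  mul_eq := by rw [mul_comm, h.mul_eq]
  pow_eq := by
    have := congrArg (· ^ (u * s)) h.mul_eq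
    simpa [mul_pow, h.pow_eq] using this
  sum_eq := h.sum_eq'
  sum_eq' := h.sum_eq
  isUnit_sub := by simpa using h.isUnit_sub.neg
  isUnit_natCast := h.isUnit_natCast

/-- In `E[x] / (x ^ (s ^ k₂) - ζ)`, suitable powers of `x` serve as the principal root of unity
`ω` of order `s ^ k₁`, and as an `s ^ k₁`-th root `η` of `ζ` or of `ζ'`. -/
theorem IsRootPair.exists_roots {s u : ℕ} {ζ ζ' ξ : E} (h : IsRootPair s u ζ ζ')
    (hξ : ξ = ζ ∨ ξ = ζ') {k₁ k₂ : ℕ} (hk₁ : 0 < k₁) (hk : k₁ ≤ k₂) :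
    ∃ (ω ω' η η' : TwistedRing E (s ^ k₂) ζ),
      (∀ e, ω ^ e ∈ monomials _ _) ∧ (∀ e, ω' ^ e ∈ monomials _ _) ∧
      (∀ e, η ^ e ∈ monomials _ _) ∧
      (∀ (c : E) e, AdjoinRoot.of _ c * η' ^ e ∈ monomials _ _) ∧
      ω * ω' = 1 ∧ η * η' = 1 ∧ ω ^ s ^ k₁ = 1 ∧ η ^ s ^ k₁ = AdjoinRoot.of _ ξ ∧
      ∀ d, ¬ s ^ k₁ ∣ d → ∑ t ∈ Finset.range (s ^ k₁), ω ^ (d * t) = 0 := by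
  have hs := h.two_le
  obtain ⟨k, rfl⟩ : ∃ k, k₁ = k + 1 := ⟨k₁ - 1, by omega⟩
  obtain ⟨d, rfl⟩ := Nat.exists_eq_add_of_le hk
  set x := TwistedRing.gen (s ^ (k + 1 + d)) ζ with hx
  have hxl : x ^ s ^ (k + 1 + d) = AdjoinRoot.of _ ζ := TwistedRing.gen_pow
  set o := s ^ (k + 1 + d) * (u * s) with ho
  have ho1 : 0 < o := Nat.mul_pos (pow_pos (by omega) _) (Nat.mul_pos h.u_pos (by omega))
  have hxo : x ^ o = 1 := by rw [ho, pow_mul, hxl, ← map_pow, h.pow_eq, map_one]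
  have hinv : ∀ e, x ^ e * x ^ (e * (o - 1)) = 1 := by
    intro e
    rw [← pow_add]
    have : e + e * (o - 1) = o * e := by
      obtain ⟨o', ho'⟩ : ∃ o', o = o' + 1 := ⟨o - 1, by omega⟩
      rw [ho']
      simp only [Nat.add_sub_cancel]
      ring
    rw [this, pow_mul, hxo, one_pow]
  obtain ⟨w, hw⟩ : ∃ w, ζ ^ w = ξ := by
    rcases hξ with rfl | rfl
    · exact ⟨1, pow_one _⟩
    · refine ⟨u * s - 1, ?_⟩
      have h1 : 0 < u * s := Nat.mul_pos h.u_pos (by omega)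
      calc ζ ^ (u * s - 1) = ζ ^ (u * s - 1) * (ζ * ξ) := by rw [h.mul_eq, mul_one]
        _ = ζ ^ (u * s) * ξ := by
          rw [← mul_assoc, ← pow_succ, Nat.sub_add_cancel h1]
        _ = ξ := by rw [h.pow_eq, one_mul]
  have hmem : ∀ e f, (x ^ e) ^ f ∈ monomials (s ^ (k + 1 + d)) ζ := by
    intro e f
    rw [← pow_mul]
    exact gen_pow_mem_monomials _ _ _
  have hωk : (x ^ (u * s * s ^ d)) ^ s ^ k = AdjoinRoot.of _ (ζ ^ u) := by
    rw [map_pow, ← hxl, ← pow_mul, ← pow_mul]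
    congr 1
    ring
  refine ⟨x ^ (u * s * s ^ d), x ^ (u * s * s ^ d * (o - 1)), x ^ (s ^ d * w),
    x ^ (s ^ d * w * (o - 1)), hmem _, hmem _, hmem _, ?_, hinv _, hinv _, ?_, ?_, ?_⟩
  · intro c e
    rw [← pow_mul]
    exact ⟨c, _, rfl⟩
  · rw [pow_succ, pow_mul, hωk, ← map_pow, ← pow_mul, h.pow_eq, map_one]
  · rw [← hw, map_pow, ← hxl, ← pow_mul, ← pow_mul]
    congr 1
    ring
  · intro e he
    refine sum_pow_eq_zero (θ := AdjoinRoot.of _ (ζ ^ u)) ?_ ?_ k _ hωk he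
    · rw [← map_pow, ← pow_mul, h.pow_eq, map_one]
    · intro i hi
      simp only [← map_pow, ← map_sum]
      rw [h.sum_eq i hi, map_zero]

variable [Nontrivial E] {Ω : Type*}

/-- Multiplication by a fixed element of `E[x] / (x ^ n - ξ)`, in any family of elements, takes
at most `T` operations on the coefficients. -/
def FixedMulWithin (Ω : Type*) (n : ℕ) [NeZero n] (ξ : E) (T : ℕ) : Prop :=
  ∀ (b : TwistedRing E n ξ) (a : Ω → TwistedRing E n ξ),
    Reaches (Set.univ : Set E) (coords (b • a)) (coords a) T

/-- The coefficients of a twisted convolution with `m = s ^ k₁` polynomials, modulo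
`x ^ l - ζ` for `l = s ^ k₂`: Fourier transform over `E[x] / (x ^ l - ζ)`, `m` multiplications in
this ring, and inverse Fourier transform. -/
theorem IsRootPair.reaches_twistedConv {s u : ℕ} [NeZero s] {ζ ζ' ξ : E}
    (h : IsRootPair s u ζ ζ') (hξ : ξ = ζ ∨ ξ = ζ') {k₁ k₂ T : ℕ} (hk₁ : 0 < k₁) (hk : k₁ ≤ k₂)
    (hT : FixedMulWithin Ω (s ^ k₂) ζ T) (α : ℕ → Ω → E[X]) (β : ℕ → E[X]) :
    Reaches (Set.univ : Set E)
      (⋃ j ∈ Finset.range (s ^ k₁), coords fun w => TwistedRing.mk (s ^ k₂) ζ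
        (twistedConv (s ^ k₁) (C ξ) (fun i => α i w) β j))
      (⋃ j ∈ Finset.range (s ^ k₁), coords fun w => TwistedRing.mk (s ^ k₂) ζ (α j w))
      (2 * (s ^ k₁ * s ^ k₂) + 2 * (s * k₁ * (s ^ k₁ * s ^ k₂)) + s ^ k₁ * T) := by
  obtain ⟨ω, ω', η, η', hω, hω', hη, hη', hωω', hηη', hωm, hηm, horth⟩ := h.exists_roots hξ hk₁ hk
  have hs := h.two_le
  set m := s ^ k₁ with hm
  have hm0 : 0 < m := pow_pos (by omega) _
  obtain ⟨mi, hmi⟩ : ∃ mi : E, (m : E) * mi = 1 := by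
    have : IsUnit (m : E) := by
      rw [hm, Nat.cast_pow]
      exact h.isUnit_natCast.pow _
    exact this.exists_right_inv
  set a : ℕ → Ω → TwistedRing E (s ^ k₂) ζ := fun j w => TwistedRing.mk _ _ (α j w) with ha
  set c : ℕ → Ω → TwistedRing E (s ^ k₂) ζ := fun j w => TwistedRing.mk _ _
    (twistedConv m (C ξ) (fun i => α i w) β j) with hc
  set b : ℕ → TwistedRing E (s ^ k₂) ζ := fun j => TwistedRing.mk _ _ (β j)
  -- Scaling by the powers of `η`, where `η ^ m = ξ`, makes the convolution cyclic.
  set a' : ℕ → Ω → TwistedRing E (s ^ k₂) ζ := fun j => η ^ j • a j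
  set c' : ℕ → Ω → TwistedRing E (s ^ k₂) ζ := fun j => η ^ j • c j
  set B : ℕ → TwistedRing E (s ^ k₂) ζ := fun t => ∑ i ∈ Finset.range m, (ω ^ t * η) ^ i * b i
  have hone : (1 : TwistedRing E (s ^ k₂) ζ) ∈ monomials (s ^ k₂) ζ := by simpa using hω 0
  -- the transform of the convolution is the product of the transforms
  have hprod : ∀ t, B t • dft ω m a' t = dft ω m c' t := by
    intro t
    funext w
    have hy : (ω ^ t * η) ^ m = TwistedRing.mk (s ^ k₂) ζ (C ξ) := by
      rw [mul_pow, ← pow_mul, mul_comm t, pow_mul, hωm, one_pow, one_mul, hηm]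
      rfl
    have := sum_mul_sum_eq_twistedConv hy (fun i => a i w) b
    simp only [dft, Finset.sum_apply, Pi.smul_apply, smul_eq_mul, a', c', B]
    have e1 : ∀ (f : ℕ → Ω → TwistedRing E (s ^ k₂) ζ) i,
        ω ^ (t * i) * (η ^ i * f i w) = (ω ^ t * η) ^ i * f i w := by
      intro f i
      rw [mul_pow, ← pow_mul, mul_assoc]
    simp only [e1]
    rw [mul_comm, this]
    refine Finset.sum_congr rfl fun j _ => ?_
    rw [hc]
    simp only
    rw [map_twistedConv]
  have hinv : ∀ j < m, (AdjoinRoot.of _ mi * η' ^ j) • dft ω' m (dft ω m c') j = c j := by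
    intro j hj
    rw [dft_dft hωm hωω' horth c' hj, smul_smul, smul_smul]
    have h1 : (AdjoinRoot.of (X ^ s ^ k₂ - C ζ) mi : TwistedRing E (s ^ k₂) ζ) * m = 1 := by
      rw [← map_natCast (AdjoinRoot.of (X ^ s ^ k₂ - C ζ)), ← map_mul, mul_comm, hmi, map_one]
    have h2 : η ^ j * η' ^ j = 1 := by rw [← mul_pow, hηη', one_pow]
    have h3 : AdjoinRoot.of (X ^ s ^ k₂ - C ζ) mi * η' ^ j * (m : TwistedRing E (s ^ k₂) ζ) *
        η ^ j = 1 := by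
      linear_combination (η ^ j * η' ^ j) * h1 + h2
    rw [h3, one_smul]
  have s1 : Reaches (monomials (s ^ k₂) ζ) (a' '' (Finset.range m : Set ℕ))
      (a '' (Finset.range m : Set ℕ)) m := by
    simpa using Reaches.image (Finset.range m) a' (d := 1) fun j hj =>
      Reaches.smul (hη j) (Set.mem_insert_of_mem _ (Set.mem_image_of_mem a (Finset.mem_coe.2 hj)))
  have s2 := (s1.trans (reaches_dft (by omega) k₁ ω a' hωm hω)).of_monomials
  have s3 : Reaches (Set.univ : Set E) (⋃ t ∈ Finset.range m, coords (dft ω m c' t))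
      (⋃ v ∈ Set.range (dft ω m a'), coords v) (m * T) := by
    have := Reaches.biUnion_const (A := (Set.univ : Set E))
      (S := ⋃ v ∈ Set.range (dft ω m a'), coords v) (Finset.range m)
      (fun t => coords (dft ω m c' t)) (d := T) fun t _ => by
        rw [← hprod]
        exact (hT (B t) (dft ω m a' t)).mono_src
          ((Set.subset_biUnion_of_mem (u := coords) (Set.mem_range_self t)).trans
            (Set.subset_insert _ _))
    simpa using this
  have hω'm : ω' ^ m = 1 := by
    calc ω' ^ m = (ω * ω') ^ m := by rw [mul_pow, hωm, one_mul]
      _ = 1 := by rw [hωω', one_pow]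
  have s4 : Reaches (monomials (s ^ k₂) ζ) (c '' (Finset.range m : Set ℕ))
      (Set.range (dft ω' m (dft ω m c'))) m := by
    have := Reaches.image (A := monomials (s ^ k₂) ζ)
      (S := Set.range (dft ω' m (dft ω m c'))) (Finset.range m) c (d := 1) fun j hj => by
        rw [← hinv j (Finset.mem_range.1 hj)]
        exact Reaches.smul (hη' mi j) (Set.mem_insert_of_mem _ (Set.mem_range_self j))
    simpa using this
  have s5 := ((reaches_dft (by omega) k₁ ω' (dft ω m c') hω'm hω').trans s4).of_monomials
  simp only [Set.biUnion_image, Finset.mem_coe] at s2 s3 s5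
  refine ((s2.trans s3).trans s5).mono_cost (le_of_eq ?_)
  rw [pow_succ, ← hm]
  ring

end FastMul

section FastMulRecursion

open Polynomial

section Blocks

variable {E : Type*} [CommRing E]

/-- The `j`-th block of `l` consecutive coefficients of `p`. -/
noncomputable def coeffBlock (l : ℕ) (p : E[X]) (j : ℕ) : E[X] :=
  ∑ i ∈ Finset.range l, C (p.coeff (l * j + i)) * X ^ i

theorem coeff_coeffBlock (l : ℕ) (p : E[X]) (j i : ℕ) :
    (coeffBlock l p j).coeff i = if i < l then p.coeff (l * j + i) else 0 := by
  rw [coeffBlock, finsetSum_coeff]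
  simp only [coeff_C_mul, coeff_X_pow]
  simp

theorem degree_coeffBlock_lt (l : ℕ) (p : E[X]) (j : ℕ) : (coeffBlock l p j).degree < l := by
  rw [degree_lt_iff_coeff_zero]
  intro i hi
  rw [coeff_coeffBlock, if_neg (not_lt.2 hi)]

theorem sum_coeffBlock {l m : ℕ} {p : E[X]} (hp : p.degree < (l * m : ℕ)) :
    ∑ j ∈ Finset.range m, (X ^ l) ^ j * coeffBlock l p j = p := by
  have h2 : p = ∑ i ∈ Finset.range (l * m), C (p.coeff i) * X ^ i := by
    by_cases h0 : p = 0
    · simp [h0]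
    · have := p.as_sum_range' (l * m) ((natDegree_lt_iff_degree_lt h0).2 hp)
      simpa [C_mul_X_pow_eq_monomial] using this
  conv_rhs => rw [h2, sum_range_mul_eq]
  refine Finset.sum_congr rfl fun j _ => ?_
  rw [coeffBlock, Finset.mul_sum]
  refine Finset.sum_congr rfl fun i _ => ?_
  rw [← pow_mul, pow_add]
  ring

theorem degree_mul_lt {a b : E[X]} {k n : ℕ} (ha : a.degree < k) (hb : b.degree < n) :
    (a * b).degree < (k + n : ℕ) := by
  by_cases h0 : a * b = 0
  · rw [h0, degree_zero]
    exact WithBot.bot_lt_coe _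
  have h1 := (natDegree_lt_iff_degree_lt (left_ne_zero_of_mul h0)).2 ha
  have h2 := (natDegree_lt_iff_degree_lt (right_ne_zero_of_mul h0)).2 hb
  rw [← natDegree_lt_iff_degree_lt h0]
  exact natDegree_mul_le.trans_lt (by omega)

theorem degree_twistedConv_lt {m l : ℕ} {a b : ℕ → E[X]} (ξ : E)
    (ha : ∀ i, (a i).degree < l) (hb : ∀ i, (b i).degree < l) (j : ℕ) :
    (twistedConv m (C ξ) a b j).degree < (2 * l : ℕ) := by
  have hab : ∀ i i', a i * b i' ∈ degreeLT E (2 * l) := by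
    intro i i'
    rw [mem_degreeLT, two_mul]
    exact degree_mul_lt (ha i) (hb i')
  rw [← mem_degreeLT]
  refine Submodule.sum_mem _ fun p _ => ?_
  split_ifs
  · exact hab _ _
  · rw [← smul_eq_C_mul]
    exact Submodule.smul_mem _ _ (hab _ _)
  · exact Submodule.zero_mem _

/-- Adding up overlapping blocks: every coefficient of the sum involves at most two blocks. -/
theorem reaches_coeffs_overlap {Ω : Type*} {l m : ℕ} (hl : 0 < l) (hm : 0 < m)
    (c : ℕ → Ω → E[X]) (hc : ∀ j w, (c j w).degree < (2 * l : ℕ)) :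
    (∀ w, (∑ j ∈ Finset.range m, (X ^ l) ^ j * c j w).degree <
      ((2 * (m * l) : ℕ) : WithBot ℕ)) ∧
    Reaches (Set.univ : Set E)
      (coeffs fun w => ∑ j ∈ Finset.range m, (X ^ l) ^ j * c j w)
      (⋃ j ∈ Finset.range m, coeffs (c j)) (2 * (m * l) * 2) := by
  have hcoeff : ∀ w t, (∑ j ∈ Finset.range m, (X ^ l) ^ j * c j w).coeff t =
      ∑ j ∈ Finset.range m with j = t / l ∨ j + 1 = t / l, (c j w).coeff (t - l * j) := by
    intro w t
    rw [finsetSum_coeff, Finset.sum_filter]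
    refine Finset.sum_congr rfl fun j _ => ?_
    rw [← pow_mul, coeff_X_pow_mul']
    have hdiv := Nat.div_add_mod t l
    have hmod := Nat.mod_lt t hl
    split_ifs with h1 h2 h2
    · rfl
    · refine coeff_eq_zero_of_degree_lt ((hc j w).trans_le ?_)
      have hj : j ≤ t / l := (Nat.le_div_iff_mul_le hl).2 (by rwa [mul_comm])
      have hj2 : j + 2 ≤ t / l := by omega
      have := Nat.mul_le_mul_left l hj2
      have h3 : 2 * l + l * j = l * (j + 2) := by ring
      exact_mod_cast (by omega : 2 * l ≤ t - l * j)
    · exfalso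
      apply h1
      have hj : j ≤ t / l := by omega
      have := Nat.mul_le_mul_left l hj
      omega
    · rfl
  have hdeg : ∀ w, (∑ j ∈ Finset.range m, (X ^ l) ^ j * c j w).degree <
      ((2 * (m * l) : ℕ) : WithBot ℕ) := by
    intro w
    rw [degree_lt_iff_coeff_zero]
    intro t ht
    rw [hcoeff]
    refine Finset.sum_eq_zero fun j hj => ?_
    rw [Finset.mem_filter, Finset.mem_range] at hj
    refine coeff_eq_zero_of_degree_lt ((hc j w).trans_le ?_)
    have h1 := Nat.mul_le_mul_left l (Nat.succ_le_of_lt hj.1)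
    have h2 : l * (j + 1) = l * j + l := by ring
    have h3 : l * m = m * l := by ring
    have h4 := Nat.mul_le_mul_right l (Nat.succ_le_of_lt hm)
    exact_mod_cast (by rw [Nat.succ_eq_add_one] at *; omega : 2 * l ≤ t - l * j)
  refine ⟨hdeg, Reaches.coeffs _ hdeg fun t _ => ?_⟩
  have := Reaches.sum (A := (Set.univ : Set E)) (S := ⋃ j ∈ Finset.range m, coeffs (c j))
    ((Finset.range m).filter fun j => j = t / l ∨ j + 1 = t / l) (fun _ => 1)
    (fun j w => (c j w).coeff (t - l * j)) (Set.mem_univ _) (fun _ _ => Set.mem_univ _)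
    fun j hj => Set.mem_insert_of_mem _
      (Set.mem_biUnion (Finset.mem_coe.2 (Finset.mem_filter.1 hj).1) ⟨_, rfl⟩)
  have hcard : ((Finset.range m).filter fun j => j = t / l ∨ j + 1 = t / l).card ≤ 2 := by
    refine (Finset.card_le_card (t := {t / l, t / l - 1}) fun j hj => ?_).trans Finset.card_le_two
    have := (Finset.mem_filter.1 hj).2
    simp only [Finset.mem_insert, Finset.mem_singleton]
    omega
  convert this.mono_cost hcard using 2
  funext w
  rw [hcoeff]
  simp

end Blocks

variable {E : Type*} [CommRing E] [Nontrivial E] {Ω : Type*}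

/-- One level of the recursion: a product modulo `x ^ (m * l) - ξ` is a product of polynomials in
`y = x ^ l` modulo `y ^ m - ξ`, whose coefficients have degree less than `2 * l` in `x` and are
recovered from their residues modulo `x ^ l - ζ` and `x ^ l - ζ'`. -/
theorem IsRootPair.fixedMulWithin_add {s u : ℕ} [NeZero s] {ζ ζ' ξ : E}
    (h : IsRootPair s u ζ ζ') (hξ : ξ = ζ ∨ ξ = ζ') {k₁ k₂ T : ℕ} (hk₁ : 0 < k₁) (hk : k₁ ≤ k₂)
    (hT : FixedMulWithin Ω (s ^ k₂) ζ T) (hT' : FixedMulWithin Ω (s ^ k₂) ζ' T) :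
    FixedMulWithin Ω (s ^ (k₁ + k₂)) ξ
      (2 * (s ^ k₁ * T) + (11 + 4 * (s * k₁)) * s ^ (k₁ + k₂)) := by
  intro b a
  have hs := h.two_le
  have hnml : s ^ (k₁ + k₂) = s ^ k₁ * s ^ k₂ := pow_add _ _ _
  set m := s ^ k₁ with hm
  set l := s ^ k₂ with hl
  have hm0 : 0 < m := pow_pos (by omega) _
  have hl0 : 0 < l := pow_pos (by omega) _
  set α : ℕ → Ω → E[X] := fun j w => coeffBlock l (TwistedRing.rep (a w)) j with hα
  set β : ℕ → E[X] := fun j => coeffBlock l (TwistedRing.rep b) j with hβ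
  set c : ℕ → Ω → E[X] := fun j w => twistedConv m (C ξ) (fun i => α i w) β j with hc
  have hcdeg : ∀ j w, (c j w).degree < (2 * l : ℕ) := fun j w =>
    degree_twistedConv_lt ξ (fun i => degree_coeffBlock_lt _ _ _)
      (fun i => degree_coeffBlock_lt _ _ _) j
  have hsrc : ∀ z : E, (⋃ j ∈ Finset.range m, coords fun w => TwistedRing.mk l z (α j w)) ⊆
      insert 0 (coords a) := by
    intro z
    refine Set.iUnion₂_subset fun j _ => ?_
    rintro _ ⟨i, rfl⟩
    simp only [hα, TwistedRing.rep_mk_of_degree_lt (degree_coeffBlock_lt _ _ _),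
      coeff_coeffBlock]
    by_cases hi : i < l
    · simp only [hi, if_true]
      exact Set.mem_insert_of_mem _ ⟨_, rfl⟩
    · simp only [hi, if_false]
      exact Set.mem_insert _ _
  have r1 := ((h.reaches_twistedConv hξ hk₁ hk hT α β).mono_src (hsrc ζ)).union
    ((h.symm.reaches_twistedConv hξ.symm hk₁ hk hT' α β).mono_src (hsrc ζ'))
  obtain ⟨δ, hδ⟩ := h.isUnit_sub.exists_right_inv
  -- the residues modulo `x ^ l - ζ` and `x ^ l - ζ'` determine the coefficients
  have r2 := r1.trans (Reaches.biUnion_const (A := (Set.univ : Set E)) (Finset.range m)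
    (fun j => coeffs (c j)) (d := 2 * l * 1) fun j hj => Reaches.coeffs _ (hcdeg j) (by
      intro e he
      have hres : ∀ (z : E) (w : Ω) (i : ℕ), i < l →
          (TwistedRing.rep (TwistedRing.mk l z (c j w))).coeff i =
            (c j w).coeff i + z * (c j w).coeff (l + i) := fun z w i hi =>
        TwistedRing.coeff_rep_mk (hcdeg j w) hi
      have key : ∀ i, i < l → ∀ x y : E, Reaches (Set.univ : Set E)
          {x • (fun w => (TwistedRing.rep (TwistedRing.mk l ζ (c j w))).coeff i) +
            y • (fun w => (TwistedRing.rep (TwistedRing.mk l ζ' (c j w))).coeff i)}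
          ((⋃ j ∈ Finset.range m, coords fun w => TwistedRing.mk l ζ (c j w)) ∪
            ⋃ j ∈ Finset.range m, coords fun w => TwistedRing.mk l ζ' (c j w)) 1 := by
        intro i _ x y
        refine Reaches.single (Set.mem_univ _) (Set.mem_univ _) (Set.mem_insert_of_mem _ ?_)
          (Set.mem_insert_of_mem _ ?_)
        · exact Or.inl (Set.mem_biUnion (Finset.mem_coe.2 hj) ⟨i, rfl⟩)
        · exact Or.inr (Set.mem_biUnion (Finset.mem_coe.2 hj) ⟨i, rfl⟩)
      by_cases hel : e < l
      · convert key e hel (1 - ζ * δ) (ζ * δ) using 2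
        funext w
        simp only [Pi.add_apply, Pi.smul_apply, smul_eq_mul, hres _ w e hel]
        linear_combination (ζ * (c j w).coeff (l + e)) * hδ
      · obtain ⟨i, rfl⟩ := Nat.exists_eq_add_of_le (not_lt.1 hel)
        convert key i (by omega) δ (-δ) using 2
        funext w
        simp only [Pi.add_apply, Pi.smul_apply, smul_eq_mul, hres _ w i (by omega)]
        linear_combination (-(c j w).coeff (l + i)) * hδ))
  obtain ⟨hQdeg, hQ⟩ := reaches_coeffs_overlap (Ω := Ω) hl0 hm0 c hcdeg
  have r3 := r2.trans hQ
  -- substituting `y = x ^ l`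
  have hprod : ∀ w, (b • a) w = TwistedRing.mk (s ^ (k₁ + k₂)) ξ
      (∑ j ∈ Finset.range m, (X ^ l) ^ j * c j w) := by
    intro w
    have hy : (TwistedRing.mk (s ^ (k₁ + k₂)) ξ (X ^ l)) ^ m =
        TwistedRing.mk (s ^ (k₁ + k₂)) ξ (C ξ) := by
      rw [map_pow, AdjoinRoot.mk_X, ← pow_mul, mul_comm, ← hnml]
      exact TwistedRing.gen_pow
    have h1 := sum_mul_sum_eq_twistedConv hy (fun i => TwistedRing.mk _ _ (α i w))
      (fun i => TwistedRing.mk _ _ (β i))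
    have hdeg : ∀ v : TwistedRing E (s ^ (k₁ + k₂)) ξ,
        (TwistedRing.rep v).degree < (l * m : ℕ) := by
      intro v
      rw [mul_comm, ← hnml]
      exact TwistedRing.degree_rep_lt v
    have h2 : ∀ v : TwistedRing E (s ^ (k₁ + k₂)) ξ, ∑ j ∈ Finset.range m,
        (TwistedRing.mk (s ^ (k₁ + k₂)) ξ (X ^ l)) ^ j * TwistedRing.mk (s ^ (k₁ + k₂)) ξ
          (coeffBlock l (TwistedRing.rep v) j) = v := by
      intro v
      simp only [← map_pow, ← map_mul, ← map_sum]
      rw [sum_coeffBlock (hdeg v), TwistedRing.mk_rep]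
    rw [Pi.smul_apply, smul_eq_mul, mul_comm, ← h2 (a w), ← h2 b]
    refine h1.trans ?_
    rw [map_sum]
    refine Finset.sum_congr rfl fun j _ => ?_
    rw [map_mul, map_pow _ (X ^ l) j, hc]
    simp only
    rw [map_twistedConv]
  have r4 := r3.trans (Reaches.coeffs (p := fun w => TwistedRing.rep ((b • a) w)) _ (d := 1)
    (fun w => TwistedRing.degree_rep_lt _) (by
      intro i hi
      have := Reaches.single (A := (Set.univ : Set E))
        (S := coeffs fun w => ∑ j ∈ Finset.range m, (X ^ l) ^ j * c j w)
        (Set.mem_univ (1 : E)) (Set.mem_univ ξ)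
        (Set.mem_insert_of_mem _ ⟨i, rfl⟩)
        (Set.mem_insert_of_mem _ ⟨s ^ (k₁ + k₂) + i, rfl⟩)
      convert this using 2
      funext w
      rw [hprod, TwistedRing.coeff_rep_mk (by rw [hnml]; exact hQdeg w) hi]
      simp))
  refine Reaches.mono_cost r4 (le_of_eq ?_)
  rw [hnml, Finset.card_range]
  ring

/-- Multiplication by a fixed element takes at most `n ^ 2` operations. -/
theorem fixedMulWithin_sq (n : ℕ) [NeZero n] (ξ : E) : FixedMulWithin Ω n ξ (n * n) := by
  intro b a
  refine Reaches.coeffs n (fun w => TwistedRing.degree_rep_lt _) fun i _ => ?_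
  have := Reaches.sum (A := (Set.univ : Set E)) (S := coords a) (Finset.range n)
    (fun j => (TwistedRing.rep (b * TwistedRing.mk n ξ (X ^ j))).coeff i)
    (fun j w => (TwistedRing.rep (a w)).coeff j) (Set.mem_univ _) (fun _ _ => Set.mem_univ _)
    fun j _ => Set.mem_insert_of_mem _ ⟨j, rfl⟩
  rw [Finset.card_range] at this
  convert this using 2
  funext w
  have hrep : TwistedRing.rep (a w) =
      ∑ j ∈ Finset.range n, (TwistedRing.rep (a w)).coeff j • (X : E[X]) ^ j := by
    by_cases h0 : TwistedRing.rep (a w) = 0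
    · simp [h0]
    · have := (TwistedRing.rep (a w)).as_sum_range' n
        ((natDegree_lt_iff_degree_lt h0).2 (TwistedRing.degree_rep_lt _))
      simpa [smul_X_eq_monomial] using this
  have hmk : a w = ∑ j ∈ Finset.range n,
      (TwistedRing.rep (a w)).coeff j • TwistedRing.mk n ξ (X ^ j) := by
    conv_lhs => rw [← TwistedRing.mk_rep (a w), hrep, map_sum]
    rfl
  rw [Pi.smul_apply, smul_eq_mul]
  conv_lhs => rw [hmk]
  rw [Finset.mul_sum, map_sum, finsetSum_coeff, Finset.sum_apply]
  refine Finset.sum_congr rfl fun j _ => ?_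
  rw [mul_smul_comm, map_smul, coeff_smul, Pi.smul_apply, smul_eq_mul, smul_eq_mul, mul_comm]

/-- Multiplication by a fixed element of `E[x] / (x ^ n - ξ)`, for `n = s ^ k` with `k ≤ 2 ^ j`,
takes `O(n k (j + 1))` operations. Every level of the recursion halves `k` and costs `O(n k)`
for all its subproblems together; there are `j` levels. -/
theorem IsRootPair.fixedMulWithin {s u : ℕ} [NeZero s] {ζ ζ' : E} (h : IsRootPair s u ζ ζ')
    (j k : ℕ) (hk : k ≤ 2 ^ j) (ξ : E) (hξ : ξ = ζ ∨ ξ = ζ') :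
    FixedMulWithin Ω (s ^ k) ξ (s ^ k * ((11 + 9 * s) * ((k - 1) * j) + s)) := by
  have hs := h.two_le
  induction j generalizing k ξ with
  | zero =>
    intro b a
    refine (fixedMulWithin_sq _ ξ b a).mono_cost (Nat.mul_le_mul_left _ ?_)
    refine le_trans ?_ (Nat.le_add_left _ _)
    calc s ^ k ≤ s ^ 1 := Nat.pow_le_pow_right (by omega) hk
      _ = s := pow_one s
  | succ j ih =>
    rcases Nat.lt_or_ge k 2 with hk2 | hk2
    · intro b a
      refine (fixedMulWithin_sq _ ξ b a).mono_cost (Nat.mul_le_mul_left _ ?_)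
      refine le_trans ?_ (Nat.le_add_left _ _)
      calc s ^ k ≤ s ^ 1 := Nat.pow_le_pow_right (by omega) (by omega)
        _ = s := pow_one s
    · obtain ⟨k₁, k₂, rfl, h1, h12, h21⟩ : ∃ k₁ k₂, k = k₁ + k₂ ∧ 0 < k₁ ∧ k₁ ≤ k₂ ∧
          k₂ ≤ k₁ + 1 := ⟨k / 2, k - k / 2, by omega, by omega, by omega, by omega⟩
      have h2j : k₂ ≤ 2 ^ j := by
        rw [pow_succ] at hk
        omega
      intro b a
      refine (h.fixedMulWithin_add hξ h1 h12 (ih k₂ h2j ζ (Or.inl rfl))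
        (ih k₂ h2j ζ' (Or.inr rfl)) b a).mono_cost ?_
      obtain ⟨e, rfl⟩ : ∃ e, k₂ = e + 1 := ⟨k₂ - 1, by omega⟩
      have e1 : k₁ + (e + 1) - 1 = k₁ + e := by omega
      have he : e ≤ k₁ := by omega
      rw [e1, Nat.add_sub_cancel, ← mul_assoc (s ^ k₁), ← pow_add]
      set n := s ^ (k₁ + (e + 1))
      have key : 2 * ((11 + 9 * s) * (e * j) + s) + (11 + 4 * (s * k₁)) ≤
          (11 + 9 * s) * ((k₁ + e) * (j + 1)) + s := by
        have a1 : e * j ≤ k₁ * j := Nat.mul_le_mul_right _ he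
        have a2 : s * 1 ≤ s * k₁ := Nat.mul_le_mul_left _ h1
        nlinarith [Nat.mul_le_mul_left (11 + 9 * s) a1, Nat.zero_le (s * e)]
      calc 2 * (n * ((11 + 9 * s) * (e * j) + s)) + (11 + 4 * (s * k₁)) * n
          = n * (2 * ((11 + 9 * s) * (e * j) + s) + (11 + 4 * (s * k₁))) := by ring
        _ ≤ _ := Nat.mul_le_mul_left _ key

end FastMulRecursion

/-! ### Fast multiplication by a fixed polynomial over a field -/

section FieldMul

open Polynomial
open scoped QuadraticAlgebra

variable {F : Type*} [Field F] {Ω : Type*}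

/-- In `F[ω]` with `ω ^ 2 + ω + 1 = 0`, which need not be a field, `ω` and `ω⁻¹ = -1 - ω`. -/
theorem isRootPair_of_three_ne_zero (h3 : (3 : F) ≠ 0) :
    IsRootPair 3 1 (⟨0, 1⟩ : QuadraticAlgebra F (-1) (-1)) ⟨-1, -1⟩ := by
  have hsum : ∀ θ : QuadraticAlgebra F (-1) (-1), 1 + θ + θ ^ 2 = 0 → ∀ i, ¬ 3 ∣ i →
      ∑ r ∈ Finset.range 3, (θ ^ 1) ^ (i * r) = 0 := by
    intro θ hθ i hi
    have hθ3 : θ ^ 3 = 1 := by linear_combination (θ - 1) * hθ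
    simp only [Finset.sum_range_succ, Finset.sum_range_zero, pow_one, mul_zero, pow_zero,
      zero_add, mul_one]
    obtain ⟨q, rfl | rfl⟩ : ∃ q, i = 3 * q + 1 ∨ i = 3 * q + 2 := ⟨i / 3, by omega⟩
    · rw [show (3 * q + 1) * 2 = 3 * (2 * q) + 2 by ring, pow_add, pow_mul, hθ3, pow_add, pow_mul,
        hθ3]
      linear_combination hθ
    · rw [show (3 * q + 2) * 2 = 3 * (2 * q + 1) + 1 by ring, pow_add, pow_mul, hθ3, pow_add,
        pow_mul, hθ3]
      linear_combination hθ
  refine ⟨one_pos, by norm_num, ?_, ?_, hsum _ ?_, hsum _ ?_, ?_, ?_⟩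
  · ext <;> simp
  · ext <;> simp [pow_succ]
  · ext <;> simp [pow_succ]
  · ext <;> simp [pow_succ]
  · refine IsUnit.of_mul_eq_one (⟨-(1 / 3), -(2 / 3)⟩ : QuadraticAlgebra F (-1) (-1)) ?_
    ext <;> simp <;> field_simp <;> ring
  · have := (IsUnit.mk0 ((3 : ℕ) : F) (by exact_mod_cast h3)).map
      (algebraMap F (QuadraticAlgebra F (-1) (-1)))
    rwa [map_natCast] at this

/-- In `F[i]` with `i ^ 2 = -1`, which need not be a field, `i` and `i⁻¹ = -i`. -/
theorem isRootPair_of_two_ne_zero (h2 : (2 : F) ≠ 0) :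
    IsRootPair 2 2 (⟨0, 1⟩ : QuadraticAlgebra F (-1) 0) ⟨0, -1⟩ := by
  have hsum : ∀ θ : QuadraticAlgebra F (-1) 0, θ ^ 2 = -1 → ∀ i, ¬ 2 ∣ i →
      ∑ r ∈ Finset.range 2, (θ ^ 2) ^ (i * r) = 0 := by
    intro θ hθ i hi
    have hi' : Odd i := Nat.not_even_iff_odd.1 fun h => hi h.two_dvd
    simp [Finset.sum_range_succ, hθ, hi'.neg_one_pow]
  refine ⟨two_pos, le_rfl, ?_, ?_, hsum _ ?_, hsum _ ?_, ?_, ?_⟩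
  · ext <;> simp
  · ext <;> simp [pow_succ]
  · ext <;> simp [pow_succ]
  · ext <;> simp [pow_succ]
  · refine IsUnit.of_mul_eq_one (⟨0, -(1 / 2)⟩ : QuadraticAlgebra F (-1) 0) ?_
    ext
    · simp
      field_simp
      ring
    · simp
  · have := (IsUnit.mk0 ((2 : ℕ) : F) (by exact_mod_cast h2)).map
      (algebraMap F (QuadraticAlgebra F (-1) 0))
    rwa [map_natCast] at this

/-- The two coordinate functions of a function with values in a quadratic algebra. -/
def quadraticCoords {a b : F} (u : Ω → QuadraticAlgebra F a b) : Set (Ω → F) :=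
  {fun w => (u w).re, fun w => (u w).im}

/-- An operation in a quadratic algebra takes at most eight operations in the base field. -/
theorem Reaches.of_quadraticAlgebra {a b : F} {S T : Set (Ω → QuadraticAlgebra F a b)} {c : ℕ}
    (h : Reaches (Set.univ : Set (QuadraticAlgebra F a b)) T S c) :
    Reaches (Set.univ : Set F) (⋃ u ∈ T, quadraticCoords u) (⋃ u ∈ S, quadraticCoords u)
      (c * 8) := by
  refine h.translate quadraticCoords ?_ fun x _ y _ u v => ?_
  · rintro _ (rfl | rfl) <;> rfl
  have key : ∀ (z : Fin 4 → F) (g : Ω → F),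
      (∀ w, g w = z 0 * (u w).re + z 1 * (u w).im + z 2 * (v w).re + z 3 * (v w).im) →
      Reaches (Set.univ : Set F) {g} (quadraticCoords u ∪ quadraticCoords v) 4 := by
    intro z g hg
    have := Reaches.sum (A := (Set.univ : Set F)) (S := quadraticCoords u ∪ quadraticCoords v)
      Finset.univ z ![fun w => (u w).re, fun w => (u w).im, fun w => (v w).re,
        fun w => (v w).im] (Set.mem_univ _) (fun _ _ => Set.mem_univ _) (by
          intro i _
          refine Set.mem_insert_of_mem _ ?_
          fin_cases i
          · exact Or.inl (Or.inl rfl)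
          · exact Or.inl (Or.inr rfl)
          · exact Or.inr (Or.inl rfl)
          · exact Or.inr (Or.inr rfl))
    rw [Finset.card_univ, Fintype.card_fin] at this
    convert this using 2
    funext w
    rw [hg]
    simp [Fin.sum_univ_four]
  refine ((key ![x.re, a * x.im, y.re, a * y.im] (fun w => ((x • u + y • v) w).re) ?_).union
    (key ![x.im, x.re + b * x.im, y.im, y.re + b * y.im] (fun w => ((x • u + y • v) w).im)
      ?_)).mono_tgt ?_
  · intro w
    simp
    ring
  · intro w
    simp
    ring
  · rintro _ (rfl | rfl)
    · exact Or.inr (Or.inl rfl)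
    · exact Or.inr (Or.inr rfl)

/-- A root pair in a quadratic algebra gives fast polynomial multiplication over the base field. -/
theorem IsRootPair.reaches_coeffs_mul {a b : F} {s u : ℕ} {ζ ζ' : QuadraticAlgebra F a b}
    (h : IsRootPair s u ζ ζ') {l j : ℕ} (hj : l + 1 ≤ 2 ^ j) (p : Ω → F[X])
    (hp : ∀ w, (p w).degree < (2 ^ l : ℕ)) (g : F[X]) (hg : g.natDegree ≤ 2 ^ l) :
    Reaches (Set.univ : Set F) (coeffs fun w => p w * g) (coeffs p)
      (s * 2 ^ (l + 1) * ((11 + 9 * s) * (l * j) + s) * 8) := by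
  have hs := h.two_le
  have : NeZero s := ⟨by omega⟩
  set k := Nat.clog s (2 ^ (l + 1)) with hk
  have h1 : 2 ^ (l + 1) ≤ s ^ k := Nat.le_pow_clog (by omega) _
  have hk1 : k ≤ l + 1 := Nat.clog_le_of_le_pow (Nat.pow_le_pow_left hs _)
  have hone : 1 < 2 ^ (l + 1) := Nat.one_lt_two_pow (by omega)
  have hk0 : 0 < k := Nat.clog_pos (by omega) hone
  have h2 : s ^ k ≤ s * 2 ^ (l + 1) := by
    have h3 : s ^ (k - 1) < 2 ^ (l + 1) := Nat.pow_pred_clog_lt_self (by omega) hone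
    calc s ^ k = s * s ^ (k - 1) := by rw [← pow_succ', Nat.sub_add_cancel hk0]
      _ ≤ s * 2 ^ (l + 1) := Nat.mul_le_mul_left _ h3.le
  set φ := algebraMap F (QuadraticAlgebra F a b) with hφ
  have hpg : ∀ w, (p w * g).degree < (2 ^ (l + 1) : ℕ) := by
    intro w
    by_cases h0 : p w * g = 0
    · rw [h0, degree_zero]
      exact WithBot.bot_lt_coe _
    rw [← natDegree_lt_iff_degree_lt h0]
    have h4 := (natDegree_lt_iff_degree_lt (left_ne_zero_of_mul h0)).2 (hp w)
    have h5 := natDegree_mul_le (p := p w) (q := g)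
    rw [pow_succ]
    omega
  have hdeg : ∀ q : F[X], q.degree < (2 ^ (l + 1) : ℕ) →
      TwistedRing.rep (TwistedRing.mk (s ^ k) ζ (q.map φ)) = q.map φ := by
    intro q hq
    refine TwistedRing.rep_mk_of_degree_lt (degree_map_le.trans_lt (hq.trans_le ?_))
    exact_mod_cast h1
  have hmul := h.fixedMulWithin (Ω := Ω) j k (hk1.trans hj) ζ (Or.inl rfl)
    (TwistedRing.mk _ _ (g.map φ)) (fun w => TwistedRing.mk _ _ ((p w).map φ))
  have hsrc : coords (fun w => TwistedRing.mk (s ^ k) ζ ((p w).map φ)) =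
      coeffs fun w => (p w).map φ := by
    unfold coords
    congr 1
    funext w
    refine hdeg _ ((hp w).trans_le ?_)
    exact_mod_cast Nat.pow_le_pow_right (by omega) (Nat.le_succ l)
  have htgt : coords (TwistedRing.mk (s ^ k) ζ (g.map φ) •
      fun w => TwistedRing.mk (s ^ k) ζ ((p w).map φ)) = coeffs fun w => (p w * g).map φ := by
    unfold coords
    congr 1
    funext w
    rw [Pi.smul_apply, smul_eq_mul, ← map_mul, mul_comm, ← Polynomial.map_mul]
    exact hdeg _ (hpg w)
  rw [hsrc, htgt] at hmul
  refine (((hmul.of_quadraticAlgebra).mono_src (S' := coeffs p) ?_).mono_tgt ?_).mono_cost ?_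
  · refine Set.iUnion₂_subset ?_
    rintro _ ⟨i, rfl⟩ _ (rfl | rfl)
    · exact Set.mem_insert_of_mem _ ⟨i, by funext w; simp [hφ, QuadraticAlgebra.algebraMap_eq]⟩
    · left
      funext w
      simp [hφ, QuadraticAlgebra.algebraMap_eq]
  · rintro _ ⟨i, rfl⟩
    refine Set.mem_insert_of_mem _ (Set.mem_biUnion (Set.mem_range_self i) (Or.inl ?_))
    funext w
    simp only [coeff_map, hφ, QuadraticAlgebra.algebraMap_eq]
  · refine Nat.mul_le_mul_right _ (Nat.mul_le_mul h2 (Nat.add_le_add_right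
      (Nat.mul_le_mul_left _ (Nat.mul_le_mul_right _ (by omega))) _))

/-- Multiplication of polynomials of degree less than `2 ^ l` by a fixed polynomial takes
`O(2 ^ l (l log l + 1))` operations, over any field. A square root of `-1` is adjoined in
characteristic `3`, a cube root of unity otherwise. -/
theorem reaches_coeffs_mul {l j : ℕ} (hj : l + 1 ≤ 2 ^ j) (p : Ω → F[X])
    (hp : ∀ w, (p w).degree < (2 ^ l : ℕ)) (g : F[X]) (hg : g.natDegree ≤ 2 ^ l) :
    Reaches (Set.univ : Set F) (coeffs fun w => p w * g) (coeffs p)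
      (2000 * (l * j + 1) * 2 ^ l) := by
  by_cases h3 : (3 : F) = 0
  · have h2 : (2 : F) ≠ 0 := by
      intro h2
      have : (1 : F) = 0 := by linear_combination h3 - h2
      exact one_ne_zero this
    refine ((isRootPair_of_two_ne_zero h2).reaches_coeffs_mul hj p hp g hg).mono_cost ?_
    rw [pow_succ]
    nlinarith [Nat.zero_le (l * j * 2 ^ l), Nat.zero_le (2 ^ l)]
  · refine ((isRootPair_of_three_ne_zero h3).reaches_coeffs_mul hj p hp g hg).mono_cost ?_
    rw [pow_succ]
    nlinarith [Nat.zero_le (l * j * 2 ^ l), Nat.zero_le (2 ^ l)]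

end FieldMul

/-! ### Cauchy matrices -/

section Cauchy

open Polynomial Lagrange

variable {F : Type*} [Field F] {Ω ι κ : Type*}

/-- The numerator of `∑ v i / (X - x i)` (`i ∈ s`) over the denominator `∏ (X - x i)`. -/
noncomputable def numerator [DecidableEq ι] (x : ι → F) (v : ι → Ω → F) (s : Finset ι) (w : Ω) :
    F[X] :=
  ∑ i ∈ s, C (v i w) * nodal (s.erase i) x

theorem degree_numerator_lt [DecidableEq ι] (x : ι → F) (v : ι → Ω → F) (s : Finset ι) (w : Ω) :
    (numerator x v s w).degree < (s.card : ℕ) := by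
  rw [numerator, ← mem_degreeLT]
  refine Submodule.sum_mem _ fun i hi => ?_
  rw [← smul_eq_C_mul]
  refine Submodule.smul_mem _ _ ?_
  rw [mem_degreeLT, degree_nodal]
  exact_mod_cast Finset.card_erase_lt_of_mem hi

theorem numerator_union [DecidableEq ι] (x : ι → F) (v : ι → Ω → F) {s t : Finset ι}
    (h : Disjoint s t) (w : Ω) :
    numerator x v (s ∪ t) w = numerator x v s w * nodal t x + numerator x v t w * nodal s x := by
  have key : ∀ {s t : Finset ι}, Disjoint s t → ∀ i ∈ s,
      nodal ((s ∪ t).erase i) x = nodal (s.erase i) x * nodal t x := by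
    intro s t h i hi
    have hit : i ∉ t := Finset.disjoint_left.1 h hi
    rw [Finset.erase_union_distrib, Finset.erase_eq_of_notMem hit]
    simp only [nodal]
    exact Finset.prod_union (h.mono_left (Finset.erase_subset _ _))
  rw [numerator, Finset.sum_union h, numerator, numerator, Finset.sum_mul, Finset.sum_mul]
  congr 1
  · exact Finset.sum_congr rfl fun i hi => by rw [key h i hi, mul_assoc]
  · exact Finset.sum_congr rfl fun i hi => by
      rw [Finset.union_comm, key h.symm i hi, mul_assoc]

theorem eval_numerator [DecidableEq ι] (x : ι → F) (v : ι → Ω → F) (s : Finset ι) (w : Ω) {z : F}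
    (hz : ∀ i ∈ s, z ≠ x i) :
    (numerator x v s w).eval z = (nodal s x).eval z * ∑ i ∈ s, (z - x i)⁻¹ * v i w := by
  rw [numerator, eval_finsetSum, Finset.mul_sum]
  refine Finset.sum_congr rfl fun i hi => ?_
  have h0 : z - x i ≠ 0 := sub_ne_zero.2 (hz i hi)
  rw [nodal_eq_mul_nodal_erase hi, eval_mul, eval_mul, eval_C, eval_sub, eval_X, eval_C]
  field_simp

theorem exists_split (l : ℕ) (s : Finset ι) (hs : s.card ≤ 2 ^ (l + 1)) [DecidableEq ι] :
    ∃ s₁ s₂, Disjoint s₁ s₂ ∧ s = s₁ ∪ s₂ ∧ s₁.card ≤ 2 ^ l ∧ s₂.card ≤ 2 ^ l := by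
  obtain ⟨s₁, h1, h2⟩ := Finset.exists_subset_card_eq (min_le_right (2 ^ l) s.card)
  refine ⟨s₁, s \ s₁, Finset.disjoint_sdiff, (Finset.union_sdiff_of_subset h1).symm, ?_, ?_⟩
  · rw [h2]
    exact min_le_left _ _
  · rw [Finset.card_sdiff_of_subset h1, h2]
    rw [pow_succ] at hs
    omega

/-- Combining fractions along a binary tree. -/
theorem reaches_coeffs_numerator [DecidableEq ι] {H j : ℕ} (hj : H + 1 ≤ 2 ^ j) (x : ι → F)
    (v : ι → Ω → F) (l : ℕ) (hl : l ≤ H) (s : Finset ι) (hs : s.card ≤ 2 ^ l) :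
    Reaches (Set.univ : Set F) (coeffs (numerator x v s)) (v '' (s : Set ι))
      (l * 2 ^ l * (2000 * (H * j + 1) + 1)) := by
  induction l generalizing s with
  | zero =>
    rw [pow_zero, Finset.card_le_one] at hs
    refine Reaches.of_subset ?_
    rintro _ ⟨e, rfl⟩
    rcases s.eq_empty_or_nonempty with rfl | ⟨i, hi⟩
    · left
      funext w
      simp [numerator]
    · obtain rfl : s = {i} :=
        Finset.eq_singleton_iff_unique_mem.2 ⟨hi, fun i' hi' => hs i' hi' i hi⟩
      by_cases he : e = 0
      · subst he
        refine Set.mem_insert_of_mem _ ⟨i, by simp, ?_⟩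
        funext w
        simp [numerator]
      · left
        funext w
        simp [numerator, coeff_C, he]
  | succ l ih =>
    obtain ⟨s₁, s₂, hd, rfl, h1, h2⟩ := exists_split l s hs
    have half : ∀ s t : Finset ι, s.card ≤ 2 ^ l → t.card ≤ 2 ^ l →
        Reaches (Set.univ : Set F) (coeffs fun w => numerator x v s w * nodal t x)
          (v '' (s : Set ι)) (l * 2 ^ l * (2000 * (H * j + 1) + 1) +
            2000 * (H * j + 1) * 2 ^ l) := by
      intro s t hs ht
      refine (ih (by omega) s hs).trans ((reaches_coeffs_mul (l := l) (j := j) (by omega) _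
        (fun w => (degree_numerator_lt x v s w).trans_le (by exact_mod_cast hs)) _
        (by rw [natDegree_nodal]; exact ht)).mono_cost ?_)
      gcongr
      omega
    have r1 := ((half s₁ s₂ h1 h2).mono_src (S' := v '' ((s₁ ∪ s₂ : Finset ι) : Set ι))
      ((Set.image_mono (by simp)).trans (Set.subset_insert _ _))).union
      ((half s₂ s₁ h2 h1).mono_src (S' := v '' ((s₁ ∪ s₂ : Finset ι) : Set ι))
      ((Set.image_mono (by simp)).trans (Set.subset_insert _ _)))
    have r2 := r1.trans (Reaches.coeffs (p := numerator x v (s₁ ∪ s₂)) (2 ^ (l + 1)) (d := 1)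
      (fun w => (degree_numerator_lt x v _ w).trans_le (by exact_mod_cast hs)) fun e _ => by
        refine Reaches.of_eq (Reaches.single (a := (1 : F)) (b := 1)
          (u := fun w => (numerator x v s₁ w * nodal s₂ x).coeff e)
          (v := fun w => (numerator x v s₂ w * nodal s₁ x).coeff e) (Set.mem_univ _)
          (Set.mem_univ _) (Set.mem_insert_of_mem _ (Or.inl ⟨e, rfl⟩))
          (Set.mem_insert_of_mem _ (Or.inr ⟨e, rfl⟩)))
          (Set.singleton_eq_singleton_iff.2 (funext fun w => ?_))
        rw [numerator_union x v hd]
        simp)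
    refine r2.mono_cost (le_of_eq ?_)
    rw [pow_succ]
    ring

/-- Barrett's formula: the quotient by `g` is the upper half of the product with a fixed
polynomial. -/
theorem coeff_divByMonic {g p : F[X]} (hg : g.Monic) {k : ℕ} (hp : p.degree < k) (i : ℕ) :
    (p /ₘ g).coeff i = (p * (X ^ k /ₘ g)).coeff (i + k) := by
  set y := p /ₘ g * X ^ k - p * (X ^ k /ₘ g) with hy
  have hgy : g * y = p * (X ^ k %ₘ g) - p %ₘ g * X ^ k := by
    have h1 := modByMonic_add_div p g
    have h2 := modByMonic_add_div (X ^ k : F[X]) g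
    rw [hy]
    linear_combination X ^ k * h1 - p * h2
  have hdeg : (g * y).degree < (g.natDegree + k : ℕ) := by
    rw [hgy]
    have hlt : ∀ q : F[X], (q %ₘ g).degree < (g.natDegree : ℕ) := fun q =>
      (degree_modByMonic_lt q hg).trans_le degree_le_natDegree
    have h1 : (p * (X ^ k %ₘ g)).degree < (g.natDegree + k : ℕ) := by
      rw [add_comm]
      exact degree_mul_lt hp (hlt _)
    have h2 : (p %ₘ g * X ^ k).degree < ((g.natDegree + k : ℕ) : WithBot ℕ) := by
      by_cases h0 : p %ₘ g = 0
      · rw [h0, zero_mul, degree_zero]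
        exact WithBot.bot_lt_coe _
      · rw [degree_mul, degree_X_pow, Nat.cast_add]
        exact WithBot.add_lt_add_right (WithBot.coe_ne_bot) (hlt p)
    exact (degree_sub_le _ _).trans_lt (max_lt h1 h2)
  have h0 : y.coeff (i + k) = 0 := by
    by_contra hne
    have hy0 : y ≠ 0 := fun h => hne (by rw [h, coeff_zero])
    have h1 := le_natDegree_of_ne_zero hne
    have h2 := (natDegree_lt_iff_degree_lt (mul_ne_zero hg.ne_zero hy0)).2 hdeg
    rw [natDegree_mul hg.ne_zero hy0] at h2
    omega
  rw [hy, coeff_sub, coeff_mul_X_pow] at h0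
  exact sub_eq_zero.1 h0

/-- Division with remainder by a fixed polynomial takes two multiplications. -/
theorem reaches_coeffs_modByMonic {H j l : ℕ} (hj : H + 1 ≤ 2 ^ j) (hl : l + 1 ≤ H)
    (p : Ω → F[X]) (hp : ∀ w, (p w).degree < (2 ^ (l + 1) : ℕ)) {g : F[X]} (hg : g.Monic)
    (hgl : g.natDegree ≤ 2 ^ l) :
    Reaches (Set.univ : Set F) (coeffs fun w => p w %ₘ g) (coeffs p)
      (2 * (2000 * (H * j + 1) * 2 ^ (l + 1)) + 2 ^ l) := by
  have hcost : 2000 * ((l + 1) * j + 1) * 2 ^ (l + 1) ≤ 2000 * (H * j + 1) * 2 ^ (l + 1) := by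
    gcongr
  have hu : (X ^ 2 ^ (l + 1) /ₘ g).natDegree ≤ 2 ^ (l + 1) := by
    rw [natDegree_divByMonic _ hg, natDegree_X_pow]
    exact Nat.sub_le _ _
  have r1 := (reaches_coeffs_mul (l := l + 1) (j := j) (by omega) p hp _ hu).mono_cost hcost
  have r2 : Reaches (Set.univ : Set F) (coeffs fun w => p w /ₘ g) (coeffs p)
      (2000 * (H * j + 1) * 2 ^ (l + 1)) := by
    refine r1.mono_tgt ?_
    rintro _ ⟨i, rfl⟩
    refine Set.mem_insert_of_mem _ ⟨i + 2 ^ (l + 1), ?_⟩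
    funext w
    exact (coeff_divByMonic hg (hp w) i).symm
  have hgl' : g.natDegree ≤ 2 ^ (l + 1) :=
    hgl.trans (Nat.pow_le_pow_right (by omega) (Nat.le_succ l))
  have r3 := r2.trans ((reaches_coeffs_mul (l := l + 1) (j := j) (by omega) (fun w => p w /ₘ g)
    (fun w => (degree_divByMonic_le _ _).trans_lt (hp w)) g hgl').mono_cost hcost)
  have r4 := r3.trans_union (Reaches.coeffs (p := fun w => p w %ₘ g) (2 ^ l) (d := 1)
    (fun w => ((degree_modByMonic_lt _ hg).trans_le degree_le_natDegree).trans_le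
      (by exact_mod_cast hgl)) fun i _ => by
        refine Reaches.of_eq (Reaches.single (a := (1 : F)) (b := -1)
          (u := fun w => (p w).coeff i) (v := fun w => (p w /ₘ g * g).coeff i) (Set.mem_univ _)
          (Set.mem_univ _) (Set.mem_insert_of_mem _ (Or.inl ⟨i, rfl⟩))
          (Set.mem_insert_of_mem _ (Or.inr ⟨i, rfl⟩)))
          (Set.singleton_eq_singleton_iff.2 (funext fun w => ?_))
        rw [modByMonic_eq_sub_mul_div, mul_comm]
        simp [sub_eq_add_neg])
  refine r4.mono_cost (le_of_eq ?_)
  ring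

/-- Evaluating at many points along a binary tree of remainders. -/
theorem reaches_eval {H j : ℕ} (hj : H + 1 ≤ 2 ^ j) (f : κ → F) (l : ℕ) (hl : l ≤ H)
    (t : Finset κ) (ht : t.card ≤ 2 ^ l) (p : Ω → F[X])
    (hp : ∀ w, (p w).degree < (2 ^ l : ℕ)) :
    Reaches (Set.univ : Set F) ((fun k w => (p w).eval (f k)) '' (t : Set κ)) (coeffs p)
      (l * 2 ^ l * (4 * (2000 * (H * j + 1)) + 1)) := by
  classical
  induction l generalizing t p with
  | zero =>
    refine Reaches.of_subset ?_
    rintro _ ⟨k, _, rfl⟩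
    refine Set.mem_insert_of_mem _ ⟨0, ?_⟩
    funext w
    have : (p w).degree ≤ 0 := by
      rw [degree_le_iff_coeff_zero]
      intro m hm
      refine coeff_eq_zero_of_degree_lt ((hp w).trans_le ?_)
      rw [pow_zero]
      exact_mod_cast hm
    simp only
    conv_rhs => rw [eq_C_of_degree_le_zero this]
    simp
  | succ l ih =>
    obtain ⟨t₁, t₂, hd, rfl, h1, h2⟩ := exists_split l t ht
    have half : ∀ t : Finset κ, t.card ≤ 2 ^ l →
        Reaches (Set.univ : Set F) ((fun k w => (p w).eval (f k)) '' (t : Set κ)) (coeffs p)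
          (2 * (2000 * (H * j + 1) * 2 ^ (l + 1)) + 2 ^ l +
            l * 2 ^ l * (4 * (2000 * (H * j + 1)) + 1)) := by
      intro t ht
      have hmon : (nodal t f).Monic := nodal_monic
      have r := (reaches_coeffs_modByMonic hj hl p hp hmon
        (by rw [natDegree_nodal]; exact ht)).trans
        (ih (by omega) t ht (fun w => p w %ₘ nodal t f) fun w =>
          (degree_modByMonic_lt _ hmon).trans_le (by
            rw [degree_nodal]
            exact_mod_cast ht))
      refine r.mono_tgt ?_
      rintro _ ⟨k, hk, rfl⟩
      refine Set.mem_insert_of_mem _ ⟨k, hk, ?_⟩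
      funext w
      simp only
      rw [modByMonic_eq_sub_mul_div, eval_sub, eval_mul,
        eval_nodal_at_node (Finset.mem_coe.1 hk), zero_mul, sub_zero]
    refine (((half t₁ h1).union (half t₂ h2)).mono_tgt ?_).mono_cost (le_of_eq ?_)
    · rw [Finset.coe_union, Set.image_union]
      exact Set.subset_insert _ _
    · rw [pow_succ]
      ring

/-- The product of the Cauchy matrix `((f k - x i)⁻¹)` with a vector. -/
theorem reaches_cauchy {H j : ℕ} (hj : H + 1 ≤ 2 ^ j) (x : ι → F) (f : κ → F) (v : ι → Ω → F)
    (s : Finset ι) (t : Finset κ) (hs : s.card ≤ 2 ^ H) (ht : t.card ≤ 2 ^ H)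
    (hfx : ∀ k ∈ t, ∀ i ∈ s, f k ≠ x i) :
    Reaches (Set.univ : Set F)
      ((fun k w => ∑ i ∈ s, (f k - x i)⁻¹ * v i w) '' (t : Set κ)) (v '' (s : Set ι))
      (2 ^ H * (10002 * (H * (H * j + 1)) + 1)) := by
  classical
  have r := (reaches_coeffs_numerator hj x v H le_rfl s hs).trans
    (reaches_eval hj f H le_rfl t ht (numerator x v s) fun w =>
      (degree_numerator_lt x v s w).trans_le (by exact_mod_cast hs))
  have r2 := r.trans (Reaches.image (A := (Set.univ : Set F)) t
    (fun k w => ∑ i ∈ s, (f k - x i)⁻¹ * v i w) (d := 1) fun k hk => by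
      have hne : (nodal s x).eval (f k) ≠ 0 := eval_nodal_not_at_node fun i hi => hfx k hk i hi
      have := Reaches.smul (A := (Set.univ : Set F)) (Set.mem_univ ((nodal s x).eval (f k))⁻¹)
        (Set.mem_insert_of_mem (0 : Ω → F)
          (Set.mem_image_of_mem (fun k w => (numerator x v s w).eval (f k)) (Finset.mem_coe.2 hk)))
      convert this using 2
      funext w
      rw [Pi.smul_apply, eval_numerator x v s w (hfx k hk), smul_eq_mul, ← mul_assoc,
        inv_mul_cancel₀ hne, one_mul])
  refine r2.mono_cost ?_
  have h1 : H * (2 ^ H) ≤ H * (H * j + 1) * 2 ^ H := by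
    gcongr
    exact Nat.le_mul_of_pos_right _ (Nat.succ_pos _)
  nlinarith

end Cauchy

/-! ### Degrees and thresholds -/

section Degrees

variable {LA LB : ℕ} {S : Finset (Fin LA × Fin LB)}

theorem minDegA_le {i : Fin LA} (hi : degA S i ≠ 0) : minDegA S ≤ degA S i :=
  Nat.sInf_le ⟨i, hi, rfl⟩

theorem minDegB_le {j : Fin LB} (hj : degB S j ≠ 0) : minDegB S ≤ degB S j :=
  Nat.sInf_le ⟨j, hj, rfl⟩

theorem degA_ne_zero {s : Fin LA × Fin LB} (hs : s ∈ S) : degA S s.1 ≠ 0 :=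
  (Finset.mem_filter.1 (fst_mem_activeA hs)).2

theorem degB_ne_zero {s : Fin LA × Fin LB} (hs : s ∈ S) : degB S s.2 ≠ 0 :=
  (Finset.mem_filter.1 (snd_mem_activeB hs)).2

theorem minDegA_pos (hS : S.Nonempty) : 0 < minDegA S := by
  obtain ⟨s, hs⟩ := hS
  obtain ⟨i, hi, h⟩ := Nat.sInf_mem (s := {d | ∃ i, degA S i ≠ 0 ∧ degA S i = d})
    ⟨_, s.1, degA_ne_zero hs, rfl⟩
  rw [minDegA, ← h]
  exact Nat.pos_of_ne_zero hi

theorem minDegB_pos (hS : S.Nonempty) : 0 < minDegB S := by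
  obtain ⟨s, hs⟩ := hS
  obtain ⟨j, hj, h⟩ := Nat.sInf_mem (s := {d | ∃ j, degB S j ≠ 0 ∧ degB S j = d})
    ⟨_, s.2, degB_ne_zero hs, rfl⟩
  rw [minDegB, ← h]
  exact Nat.pos_of_ne_zero hj

theorem degA_eq_card (i : Fin LA) :
    (Finset.univ.filter fun q : {s // s ∈ S} => q.1.1 = i).card = degA S i := by
  rw [degA]
  refine Finset.card_bij (fun q _ => q.1.2) ?_ ?_ ?_
  · rintro ⟨⟨a, b⟩, hq⟩ h
    simp only [Finset.mem_filter, Finset.mem_univ, true_and] at h ⊢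
    exact h ▸ hq
  · rintro ⟨⟨a, b⟩, hq⟩ h ⟨⟨a', b'⟩, hq'⟩ h' e
    simp only [Finset.mem_filter, Finset.mem_univ, true_and] at h h' e
    simp [h, h', e]
  · intro j hj
    exact ⟨⟨(i, j), (Finset.mem_filter.1 hj).2⟩, by simp, rfl⟩

theorem degB_eq_card (j : Fin LB) :
    (Finset.univ.filter fun q : {s // s ∈ S} => q.1.2 = j).card = degB S j := by
  rw [degB]
  refine Finset.card_bij (fun q _ => q.1.1) ?_ ?_ ?_
  · rintro ⟨⟨a, b⟩, hq⟩ h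
    simp only [Finset.mem_filter, Finset.mem_univ, true_and] at h ⊢
    exact h ▸ hq
  · rintro ⟨⟨a, b⟩, hq⟩ h ⟨⟨a', b'⟩, hq'⟩ h' e
    simp only [Finset.mem_filter, Finset.mem_univ, true_and] at h h' e
    simp [h, h', e]
  · intro i hi
    exact ⟨⟨(i, j), (Finset.mem_filter.1 hi).2⟩, by simp, rfl⟩

/-- The edges at the two ends of an edge overlap in this edge only. -/
theorem minDegA_add_minDegB_le (hS : S.Nonempty) : minDegA S + minDegB S ≤ S.card + 1 := by
  classical
  obtain ⟨⟨i, j⟩, hs⟩ := hS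
  have h1 := minDegA_le (degA_ne_zero hs)
  have h2 := minDegB_le (degB_ne_zero hs)
  rw [← degA_eq_card] at h1
  rw [← degB_eq_card] at h2
  have h3 := Finset.card_union_add_card_inter
    (Finset.univ.filter fun q : {s // s ∈ S} => q.1.1 = i)
    (Finset.univ.filter fun q : {s // s ∈ S} => q.1.2 = j)
  have h4 : ((Finset.univ.filter fun q : {s // s ∈ S} => q.1.1 = i) ∪
      (Finset.univ.filter fun q : {s // s ∈ S} => q.1.2 = j)).card ≤ S.card := by
    refine (Finset.card_le_univ _).trans_eq ?_
    simp
  have h5 : ((Finset.univ.filter fun q : {s // s ∈ S} => q.1.1 = i) ∩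
      (Finset.univ.filter fun q : {s // s ∈ S} => q.1.2 = j)).card ≤ 1 := by
    rw [Finset.card_le_one]
    rintro ⟨⟨a, b⟩, hq⟩ h ⟨⟨a', b'⟩, hq'⟩ h'
    simp only [Finset.mem_inter, Finset.mem_filter, Finset.mem_univ, true_and] at h h'
    simp [h.1, h.2, h'.1, h'.2]
  simp only at h1 h2
  omega

/-- Together with `type1Threshold_le`, this says that the threshold is of order `R * |S|`. -/
theorem le_type1Threshold (hS : S.Nonempty) {R ρ : ℕ} (hρ : 0 < ρ) :
    ((R * S.card : ℕ) : ℤ) ≤ type1Threshold S R ρ := by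
  have h1 := minDegA_add_minDegB_le hS
  have h2 : S.card ≤ ρ * S.card := Nat.le_mul_of_pos_left _ hρ
  have h3 : ((minDegA S : ℤ) + minDegB S) ≤ S.card + 1 := by exact_mod_cast h1
  have h4 : (S.card : ℤ) ≤ ρ * S.card := by exact_mod_cast h2
  rw [type1Threshold]
  push_cast
  linarith

theorem type1Threshold_le (hS : S.Nonempty) {R ρ : ℕ} (hρ : ρ ≤ R) :
    type1Threshold S R ρ ≤ ((2 * (R * S.card) : ℕ) : ℤ) := by
  have h1 : (1 : ℤ) ≤ minDegA S := by exact_mod_cast minDegA_pos hS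
  have h2 : (1 : ℤ) ≤ minDegB S := by exact_mod_cast minDegB_pos hS
  have h3 : (ρ : ℤ) * S.card ≤ R * S.card := by exact_mod_cast Nat.mul_le_mul_right _ hρ
  rw [type1Threshold]
  push_cast
  linarith

theorem PowerAssignment.powA_type1 (P : PowerAssignment (type1Tasks S)) (q : {s // s ∈ S})
    (i : Fin LA) : P.powA q i = if q.1.1 = i then 1 else 0 := by
  split_ifs with h
  · subst h
    rcases P.shape q with hs | hs
    · obtain ⟨x, hx, h⟩ := hs.1 q.1.1 (by simp [type1Tasks])
      simp only [type1Tasks, Finset.card_singleton, Finset.mem_Icc] at hx h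
      omega
    · obtain ⟨y, hy, h⟩ := hs.2 q.1.1 (by simp [type1Tasks])
      simp only [type1Tasks, Finset.card_singleton, Finset.mem_Icc] at hy h
      omega
  · refine P.powA_eq_zero q i ?_
    simp only [type1Tasks, Finset.mem_singleton]
    exact fun e => h e.symm

theorem PowerAssignment.powB_type1 (P : PowerAssignment (type1Tasks S)) (q : {s // s ∈ S})
    (j : Fin LB) : P.powB q j = if q.1.2 = j then 1 else 0 := by
  split_ifs with h
  · subst h
    rcases P.shape q with hs | hs
    · obtain ⟨y, hy, h⟩ := hs.2 q.1.2 (by simp [type1Tasks])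
      simp only [type1Tasks, Finset.card_singleton, Finset.mem_Icc] at hy h
      omega
    · obtain ⟨x, hx, h⟩ := hs.1 q.1.2 (by simp [type1Tasks])
      simp only [type1Tasks, Finset.card_singleton, Finset.mem_Icc] at hx h
      omega
  · refine P.powB_eq_zero q j ?_
    simp only [type1Tasks, Finset.mem_singleton]
    exact fun e => h e.symm

theorem nonempty_powerAssignment_type1 : Nonempty (PowerAssignment (type1Tasks S)) := by
  refine ⟨⟨fun q i => if q.1.1 = i then 1 else 0, fun q j => if q.1.2 = j then 1 else 0,
    ?_, ?_, ?_, ?_, ?_⟩⟩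
  · intro q i hi
    rw [if_neg]
    rintro rfl
    exact hi (by simp [type1Tasks])
  · intro q j hj
    rw [if_neg]
    rintro rfl
    exact hj (by simp [type1Tasks])
  · intro q
    left
    constructor
    · intro i hi
      have : q.1.1 = i := by simpa [type1Tasks, eq_comm] using hi
      exact ⟨1, by simp [type1Tasks], by simp [type1Tasks, this]⟩
    · intro j hj
      have : q.1.2 = j := by simpa [type1Tasks, eq_comm] using hj
      exact ⟨1, by simp [type1Tasks], by simp [type1Tasks, this]⟩
  · intro q i i' h1 h2
    by_cases h : q.1.1 = i
    · by_cases h' : q.1.1 = i'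
      · exact h.symm.trans h'
      · simp only [if_pos h, if_neg h'] at h2
        omega
    · simp [h] at h1
  · intro q j j' h1 h2
    by_cases h : q.1.2 = j
    · by_cases h' : q.1.2 = j'
      · exact h.symm.trans h'
      · simp only [if_pos h, if_neg h'] at h2
        omega
    · simp [h] at h1

theorem card_part {R ρ : ℕ} (hρ : 0 < ρ) (hR : ρ ∣ R) (h : Fin (R / ρ)) :
    (part R ρ h).card = ρ := by
  have hlt : ∀ t < ρ, h.val * ρ + t < R := by
    intro t ht
    have h1 := Nat.mul_le_mul_right ρ (Nat.succ_le_of_lt h.2)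
    rw [Nat.div_mul_cancel hR, Nat.succ_mul] at h1
    omega
  refine Eq.trans ?_ (Finset.card_range ρ)
  symm
  refine Finset.card_bij (fun t ht => ⟨h.val * ρ + t, hlt t (Finset.mem_range.1 ht)⟩) ?_ ?_ ?_
  · intro t ht
    have := Finset.mem_range.1 ht
    simp only [part, Finset.mem_filter, Finset.mem_univ, true_and]
    rw [mul_comm, Nat.mul_add_div hρ, Nat.div_eq_of_lt this, add_zero]
  · intro t _ t' _ e
    simpa using e
  · intro r hr
    simp only [part, Finset.mem_filter, Finset.mem_univ, true_and] at hr
    refine ⟨r.val % ρ, Finset.mem_range.2 (Nat.mod_lt _ hρ), Fin.ext ?_⟩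
    simp only [← hr]
    rw [mul_comm]
    exact Nat.div_add_mod _ _

/-- The part that contains `r`. -/
def partOf {R ρ : ℕ} (hR : ρ ∣ R) (r : Fin R) : Fin (R / ρ) :=
  ⟨r.val / ρ, Nat.div_lt_div_of_lt_of_dvd hR r.2⟩

theorem mem_part {R ρ : ℕ} (hR : ρ ∣ R) (r : Fin R) (h : Fin (R / ρ)) :
    r ∈ part R ρ h ↔ h = partOf hR r := by
  simp [part, partOf, Fin.ext_iff, eq_comm]

end Degrees

/-! ### Bilinear algorithms -/

section Bilinear

variable {F : Type*} [Field F]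

/-- The schoolbook algorithm, with one multiplication for each triple of indices. -/
theorem exists_isBilinearAlgorithm (m p n : ℕ) :
    ∃ (R : ℕ) (a : Fin R → Matrix (Fin m) (Fin p) F) (b : Fin R → Matrix (Fin p) (Fin n) F)
      (c : Fin R → Matrix (Fin m) (Fin n) F), IsBilinearAlgorithm a b c := by
  classical
  let e : Fin (Fintype.card (Fin m × Fin p × Fin n)) ≃ Fin m × Fin p × Fin n :=
    (Fintype.equivFin _).symm
  refine ⟨_, fun t => Matrix.single (e t).1 (e t).2.1 1,
    fun t => Matrix.single (e t).2.1 (e t).2.2 1,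
    fun t => Matrix.single (e t).1 (e t).2.2 1, fun X Y j k => ?_⟩
  rw [Equiv.sum_comp e (fun t => Matrix.single t.1 t.2.2 (1 : F) j k *
    (∑ q, ∑ r, Matrix.single t.1 t.2.1 (1 : F) q r * X q r) *
    (∑ r, ∑ s, Matrix.single t.2.1 t.2.2 (1 : F) r s * Y r s))]
  simp only [Fintype.sum_prod_type, Matrix.mul_apply, Matrix.single_apply, ite_mul, one_mul,
    zero_mul, ite_and, Finset.sum_ite_eq, Finset.sum_ite_eq', Finset.mem_univ, if_true,
    Finset.sum_ite_irrel, Finset.sum_const_zero]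

theorem exists_isBilinearAlgorithm_bilinearComplexity (m p n : ℕ) :
    ∃ (a : Fin (bilinearComplexity F m p n) → Matrix (Fin m) (Fin p) F)
      (b : Fin (bilinearComplexity F m p n) → Matrix (Fin p) (Fin n) F)
      (c : Fin (bilinearComplexity F m p n) → Matrix (Fin m) (Fin n) F),
      IsBilinearAlgorithm a b c :=
  Nat.sInf_mem (exists_isBilinearAlgorithm (F := F) m p n)

theorem bilinearComplexity_pos {m p n : ℕ} (hm : 0 < m) (hp : 0 < p) (hn : 0 < n) :
    0 < bilinearComplexity F m p n := by
  obtain ⟨a, b, c, h⟩ := exists_isBilinearAlgorithm_bilinearComplexity (F := F) m p n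
  rw [Nat.pos_iff_ne_zero]
  intro h0
  have h1 := h (Matrix.single ⟨0, hm⟩ ⟨0, hp⟩ 1) (Matrix.single ⟨0, hp⟩ ⟨0, hn⟩ 1) ⟨0, hm⟩ ⟨0, hn⟩
  have : IsEmpty (Fin (bilinearComplexity F m p n)) := by
    rw [h0]
    infer_instance
  rw [Finset.univ_eq_empty, Finset.sum_empty, Matrix.single_mul_single_same] at h1
  simp at h1

theorem nonempty_setup [Fintype F] {m p n K : ℕ} {Q : Type} [Fintype Q]
    (hF : bilinearComplexity F m p n * Fintype.card Q + K < Fintype.card F) :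
    Nonempty (Setup F m p n (bilinearComplexity F m p n) Q K) := by
  obtain ⟨a, b, c, h⟩ := exists_isBilinearAlgorithm_bilinearComplexity (F := F) m p n
  obtain ⟨f⟩ : Nonempty ((Fin (bilinearComplexity F m p n) × Q) ⊕ Fin K ↪ F) := by
    refine Function.Embedding.nonempty_of_card_le ?_
    simpa using hF.le
  exact ⟨⟨a, b, c, h, f ∘ Sum.inl, f ∘ Sum.inr, by
    rw [Sum.elim_comp_inl_inr]
    exact f.injective⟩⟩

variable {m p n R α β γ : ℕ}

/-- A bilinear algorithm for scalar matrices multiplies block matrices as well. -/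
theorem mul_apply_eq_sum_mixBlocks {a : Fin R → Matrix (Fin m) (Fin p) F}
    {b : Fin R → Matrix (Fin p) (Fin n) F} {c : Fin R → Matrix (Fin m) (Fin n) F}
    (h : IsBilinearAlgorithm a b c) (hm : m ∣ α) (hp : p ∣ β) (hn : n ∣ γ)
    (A : Matrix (Fin α) (Fin β) F) (B : Matrix (Fin β) (Fin γ) F) (k : Fin m) (l : Fin n)
    (u : Fin (α / m)) (v : Fin (γ / n)) :
    (A * B) (Fin.cast (Nat.mul_div_cancel' hm) (finProdFinEquiv (k, u)))
      (Fin.cast (Nat.mul_div_cancel' hn) (finProdFinEquiv (l, v))) =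
    ∑ r, c r k l * (mixBlocks hm hp (a r) A * mixBlocks hp hn (b r) B) u v := by
  have key : ∀ w : Fin (β / p), ∑ l', block hm hp A k l' u w * block hp hn B l' l w v =
      ∑ r, c r k l * (mixBlocks hm hp (a r) A u w * mixBlocks hp hn (b r) B w v) := by
    intro w
    have := h (Matrix.of fun k l' => block hm hp A k l' u w)
      (Matrix.of fun l' l => block hp hn B l' l w v) k l
    rw [Matrix.mul_apply] at this
    simp only [Matrix.of_apply] at this
    rw [← this]
    refine Finset.sum_congr rfl fun r _ => ?_
    simp only [mixBlocks, Matrix.sum_apply, Matrix.smul_apply, smul_eq_mul, mul_assoc]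
  simp only [Matrix.mul_apply, Finset.mul_sum]
  rw [Finset.sum_comm]
  simp only [← key]
  rw [← (finCongr (Nat.mul_div_cancel' hp)).sum_comp, ← finProdFinEquiv.sum_comp,
    Fintype.sum_prod_type, Finset.sum_comm]
  rfl

end Bilinear

/-! ### The responses as values of a polynomial -/

section Response

open Polynomial Lagrange

variable {F : Type*} [Field F] {LA LB α β γ m p n R K : ℕ} {S : Finset (Fin LA × Fin LB)}

theorem prod_mul_inv_eq_nodal {T Q : Type} [Fintype Q] [DecidableEq T] [DecidableEq Q]
    (f : T × Q → F) (W : Finset (T × Q)) (r : T) (φ : Q → Prop) [DecidablePred φ]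
    (hW : ∀ q, (r, q) ∈ W) {z : F} (hz : ∀ t, z ≠ f t) :
    (∏ t ∈ W, (z - f t)) * (∏ q, (z - f (r, q)) ^ (if φ q then 1 else 0))⁻¹ =
      (nodal (W.filter fun t => ¬ (t.1 = r ∧ φ t.2)) f).eval z := by
  have h1 : ∏ q, (z - f (r, q)) ^ (if φ q then 1 else 0) =
      ∏ t ∈ W.filter fun t => t.1 = r ∧ φ t.2, (z - f t) := by
    simp only [pow_ite, pow_one, pow_zero]
    rw [← Finset.prod_filter]
    refine Finset.prod_bij (fun q _ => (r, q)) ?_ ?_ ?_ ?_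
    · intro q hq
      simp [hW q, (Finset.mem_filter.1 hq).2]
    · intro q _ q' _ e
      simpa using e
    · rintro ⟨r', q⟩ h
      simp only [Finset.mem_filter] at h
      exact ⟨q, by simp [h.2.2], by rw [h.2.1]⟩
    · intro q _
      rfl
  have h0 : ∏ t ∈ W.filter fun t => t.1 = r ∧ φ t.2, (z - f t) ≠ 0 :=
    Finset.prod_ne_zero_iff.2 fun t _ => sub_ne_zero.2 (hz t)
  rw [h1, eval_nodal, ← Finset.prod_filter_mul_prod_filter_not W (fun t => t.1 = r ∧ φ t.2),
    mul_comm, ← mul_assoc, inv_mul_cancel₀ h0, one_mul]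

theorem card_filter_not_row {T Q : Type} [Fintype Q] [DecidableEq T] [DecidableEq Q]
    (W : Finset (T × Q)) (r : T) (φ : Q → Prop) [DecidablePred φ] (hW : ∀ q, (r, q) ∈ W) :
    (W.filter fun t => ¬ (t.1 = r ∧ φ t.2)).card + (Finset.univ.filter φ).card = W.card := by
  have h1 : (Finset.univ.filter φ).card = (W.filter fun t => t.1 = r ∧ φ t.2).card := by
    refine Finset.card_bij (fun q _ => (r, q)) ?_ ?_ ?_
    · intro q hq
      simp [hW q, (Finset.mem_filter.1 hq).2]
    · intro q _ q' _ e
      simpa using e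
    · rintro ⟨r', q⟩ h
      simp only [Finset.mem_filter] at h
      exact ⟨q, by simp [h.2.2], by rw [h.2.1]⟩
  rw [h1, add_comm]
  exact Finset.card_filter_add_card_filter_not _

/-- `Θ_h(X) / ∏ (X - f_{r,q})` over the tasks `q` with first component `i`, for `r` in part `h`. -/
noncomputable def factorA (D : Setup F m p n R {s // s ∈ S} K) (ρ : ℕ) (h : Fin (R / ρ))
    (r : Fin R) (i : Fin LA) : F[X] :=
  nodal ((part R ρ h ×ˢ Finset.univ).filter fun t => ¬ (t.1 = r ∧ t.2.1.1 = i)) D.pole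

/-- `∏ (X - f_t)` over all poles, divided by `∏ (X - f_{r,q})` over the tasks `q` with second
component `j`. -/
noncomputable def factorB (D : Setup F m p n R {s // s ∈ S} K) (r : Fin R) (j : Fin LB) : F[X] :=
  nodal (Finset.univ.filter fun t => ¬ (t.1 = r ∧ t.2.1.2 = j)) D.pole

/-- The polynomial whose value at an evaluation point is the entry `(u, v)` of the response,
multiplied by the product of the distances to all poles. -/
noncomputable def responsePoly (D : Setup F m p n R {s // s ∈ S} K) (hm : m ∣ α) (hp : p ∣ β)
    (hn : n ∣ γ) (ρ : ℕ) (A : Fin LA → Matrix (Fin α) (Fin β) F)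
    (B : Fin LB → Matrix (Fin β) (Fin γ) F) (u : Fin (α / m)) (v : Fin (γ / n)) : F[X] :=
  ∑ h : Fin (R / ρ), ∑ i ∈ activeA S, ∑ r ∈ part R ρ h, ∑ j ∈ activeB S, ∑ r' ∈ part R ρ h,
    C ((mixBlocks hm hp (D.a r) (A i) * mixBlocks hp hn (D.b r') (B j)) u v) *
      (factorA D ρ h r i * factorB D r' j)

variable (D : Setup F m p n R {s // s ∈ S} K) (P : PowerAssignment (type1Tasks S))
  (hm : m ∣ α) (hp : p ∣ β) (hn : n ∣ γ) (ρ : ℕ) (A : Fin LA → Matrix (Fin α) (Fin β) F)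
  (B : Fin LB → Matrix (Fin β) (Fin γ) F)

theorem degree_responsePoly_lt (hρ : 0 < ρ) (hR : ρ ∣ R) (u : Fin (α / m)) (v : Fin (γ / n)) :
    (responsePoly D hm hp hn ρ A B u v).degree < ((type1Threshold S R ρ).toNat : ℕ) := by
  rw [← mem_degreeLT]
  refine Submodule.sum_mem _ fun h _ => Submodule.sum_mem _ fun i hi => Submodule.sum_mem _
    fun r hr => Submodule.sum_mem _ fun j hj => Submodule.sum_mem _ fun r' hr' => ?_
  rw [← smul_eq_C_mul]
  refine Submodule.smul_mem _ _ ?_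
  rw [mem_degreeLT, factorA, factorB, degree_mul, degree_nodal, degree_nodal]
  have h1 := card_filter_not_row (part R ρ h ×ˢ (Finset.univ : Finset {s // s ∈ S})) r
    (fun q => q.1.1 = i) fun q => by simp [hr]
  have h2 := card_filter_not_row (Finset.univ : Finset (Fin R × {s // s ∈ S})) r'
    (fun q => q.1.2 = j) fun q => by simp
  rw [degA_eq_card, Finset.card_product, card_part hρ hR] at h1
  rw [degB_eq_card, Finset.card_univ, Fintype.card_prod, Fintype.card_fin] at h2
  have h3 := minDegA_le (Finset.mem_filter.1 hi).2
  have h4 := minDegB_le (Finset.mem_filter.1 hj).2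
  have hS : (Finset.univ : Finset {s // s ∈ S}).card = S.card := by simp
  rw [hS] at h1
  rw [Fintype.card_coe] at h2
  have h5 : ((Finset.filter (fun t : Fin R × {s // s ∈ S} => ¬ (t.1 = r ∧ t.2.1.1 = i))
      (part R ρ h ×ˢ Finset.univ)).card : ℤ) + degA S i = ρ * S.card := by exact_mod_cast h1
  have h6 : ((Finset.filter (fun t : Fin R × {s // s ∈ S} => ¬ (t.1 = r' ∧ t.2.1.2 = j))
      Finset.univ).card : ℤ) + degB S j = R * S.card := by exact_mod_cast h2
  have h7 : (minDegA S : ℤ) ≤ degA S i := by exact_mod_cast h3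
  have h8 : (minDegB S : ℤ) ≤ degB S j := by exact_mod_cast h4
  have h9 : ((Finset.filter (fun t : Fin R × {s // s ∈ S} => ¬ (t.1 = r ∧ t.2.1.1 = i))
      (part R ρ h ×ˢ Finset.univ)).card + (Finset.filter (fun t : Fin R × {s // s ∈ S} =>
        ¬ (t.1 = r' ∧ t.2.1.2 = j)) Finset.univ).card) < (type1Threshold S R ρ).toNat := by
    rw [Int.lt_toNat, type1Threshold]
    push_cast
    linarith
  exact_mod_cast h9

theorem eval_responsePoly (u : Fin (α / m)) (v : Fin (γ / n)) {z : F}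
    (hz : ∀ t, z ≠ D.pole t) :
    (responsePoly D hm hp hn ρ A B u v).eval z = (nodal Finset.univ D.pole).eval z *
      ∑ h : Fin (R / ρ), (encPartA D P hm hp ρ h A z * encPartB D P hp hn ρ h B z) u v := by
  have hA : ∀ (h : Fin (R / ρ)) r i, r ∈ part R ρ h → (factorA D ρ h r i).eval z =
      theta D (type1Tasks S) ρ h z * (∏ q, (z - D.pole (r, q)) ^ P.powA q i)⁻¹ := by
    intro h r i hr
    rw [factorA, ← prod_mul_inv_eq_nodal D.pole (part R ρ h ×ˢ Finset.univ) r
      (fun q : {s // s ∈ S} => q.1.1 = i) (fun q => by simp [hr]) hz]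
    simp only [P.powA_type1]
    rw [theta, Finset.prod_product]
    simp [TaskAssignment.size, type1Tasks]
  have hB : ∀ r j, (factorB D r j).eval z =
      (nodal Finset.univ D.pole).eval z * (∏ q, (z - D.pole (r, q)) ^ P.powB q j)⁻¹ := by
    intro r j
    rw [factorB, ← prod_mul_inv_eq_nodal D.pole Finset.univ r
      (fun q : {s // s ∈ S} => q.1.2 = j) (fun q => by simp) hz, eval_nodal]
    simp only [P.powB_type1]
  rw [responsePoly, eval_finsetSum, Finset.mul_sum]
  refine Finset.sum_congr rfl fun h _ => ?_
  simp only [eval_finsetSum, encPartA, Matrix.smul_mul, Matrix.sum_mul]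
  simp only [encPartB, Matrix.mul_sum, Matrix.mul_smul, Matrix.smul_apply, Matrix.sum_apply,
    smul_eq_mul, Finset.mul_sum]
  refine Finset.sum_congr rfl fun i _ => ?_
  refine Finset.sum_congr rfl fun r hr => ?_
  refine Finset.sum_congr rfl fun j _ => ?_
  refine Finset.sum_congr rfl fun r' _ => ?_
  rw [eval_mul, eval_mul, eval_C, hA h r i hr, hB r' j]
  ring

/-- The factor that relates the value of `responsePoly` at a pole to the corresponding product. -/
noncomputable def residueFactor (hR : ρ ∣ R) (t : Fin R × {s // s ∈ S}) : F :=
  (factorA D ρ (partOf hR t.1) t.1 t.2.1.1 * factorB D t.1 t.2.1.2).eval (D.pole t)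

theorem pole_injective : Function.Injective D.pole := by
  intro t t' h
  have := @D.distinct (Sum.inl t) (Sum.inl t') h
  exact Sum.inl_injective this

theorem point_injective : Function.Injective D.point := by
  intro t t' h
  have := @D.distinct (Sum.inr t) (Sum.inr t') h
  exact Sum.inr_injective this

theorem pole_ne_point (t : Fin R × {s // s ∈ S}) (k : Fin K) : D.pole t ≠ D.point k := by
  intro h
  have := @D.distinct (Sum.inl t) (Sum.inr k) h
  cases this

theorem eval_nodal_pole_eq_zero_iff (W : Finset (Fin R × {s // s ∈ S}))
    (t : Fin R × {s // s ∈ S}) : (nodal W D.pole).eval (D.pole t) = 0 ↔ t ∈ W := by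
  constructor
  · intro h
    rw [eval_nodal, Finset.prod_eq_zero_iff] at h
    obtain ⟨t', ht', h⟩ := h
    rwa [pole_injective D (sub_eq_zero.1 h)]
  · exact fun h => eval_nodal_at_node h

theorem residueFactor_ne_zero (hR : ρ ∣ R) (t : Fin R × {s // s ∈ S}) :
    residueFactor D ρ hR t ≠ 0 := by
  rw [residueFactor, eval_mul]
  refine mul_ne_zero (fun h => ?_) (fun h => ?_)
  · rw [factorA, eval_nodal_pole_eq_zero_iff] at h
    simp at h
  · rw [factorB, eval_nodal_pole_eq_zero_iff] at h
    simp at h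

/-- At the pole `f_{r,q}` with `q = (i, j)` only the product `A_i^r * B_j^r` survives. -/
theorem eval_responsePoly_pole (hR : ρ ∣ R) (u : Fin (α / m)) (v : Fin (γ / n))
    (t : Fin R × {s // s ∈ S}) :
    (responsePoly D hm hp hn ρ A B u v).eval (D.pole t) = residueFactor D ρ hR t *
      (mixBlocks hm hp (D.a t.1) (A t.2.1.1) * mixBlocks hp hn (D.b t.1) (B t.2.1.2)) u v := by
  have hB : ∀ r' j, ¬ (r' = t.1 ∧ j = t.2.1.2) → (factorB D r' j).eval (D.pole t) = 0 := by
    intro r' j h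
    rw [factorB, eval_nodal_pole_eq_zero_iff]
    simp only [Finset.mem_filter, Finset.mem_univ, true_and]
    exact fun e => h ⟨e.1.symm, e.2.symm⟩
  have hA : ∀ h r i, h = partOf hR t.1 → ¬ (r = t.1 ∧ i = t.2.1.1) →
      (factorA D ρ h r i).eval (D.pole t) = 0 := by
    intro h r i hh hn
    rw [factorA, eval_nodal_pole_eq_zero_iff]
    simp only [Finset.mem_filter, Finset.mem_product, Finset.mem_univ, and_true, mem_part hR]
    exact ⟨hh, fun e => hn ⟨e.1.symm, e.2.symm⟩⟩
  have hterm : ∀ h r i r' j, ¬ (h = partOf hR t.1 ∧ (r = t.1 ∧ i = t.2.1.1) ∧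
      (r' = t.1 ∧ j = t.2.1.2)) → r' ∈ part R ρ h →
      (C ((mixBlocks hm hp (D.a r) (A i) * mixBlocks hp hn (D.b r') (B j)) u v) *
        (factorA D ρ h r i * factorB D r' j)).eval (D.pole t) = 0 := by
    intro h r i r' j hne hr'
    rw [eval_mul, eval_mul]
    by_cases h1 : r' = t.1 ∧ j = t.2.1.2
    · have hh : h = partOf hR t.1 := by rw [← h1.1, ← mem_part hR]; exact hr'
      rw [hA h r i hh fun h2 => hne ⟨hh, h2, h1⟩, zero_mul, mul_zero]
    · rw [hB r' j h1, mul_zero, mul_zero]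
  have hmem : t.1 ∈ part R ρ (partOf hR t.1) := (mem_part hR _ _).2 rfl
  have hi := fst_mem_activeA t.2.2
  have hj := snd_mem_activeB t.2.2
  simp only [responsePoly, eval_finsetSum]
  rw [Finset.sum_eq_single (partOf hR t.1), Finset.sum_eq_single t.2.1.1,
    Finset.sum_eq_single t.1, Finset.sum_eq_single t.2.1.2, Finset.sum_eq_single t.1]
  · rw [eval_mul, eval_C, residueFactor, mul_comm]
  · exact fun r' hr' hne => hterm _ _ _ _ _ (fun e => hne e.2.2.1) hr'
  · exact fun h => absurd hmem h
  · exact fun j _ hne => Finset.sum_eq_zero fun r' hr' =>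
      hterm _ _ _ _ _ (fun e => hne e.2.2.2) hr'
  · exact fun h => absurd hj h
  · exact fun r _ hne => Finset.sum_eq_zero fun j _ => Finset.sum_eq_zero fun r' hr' =>
      hterm _ _ _ _ _ (fun e => hne e.2.1.1) hr'
  · exact fun h => absurd hmem h
  · exact fun i _ hne => Finset.sum_eq_zero fun r _ => Finset.sum_eq_zero fun j _ =>
      Finset.sum_eq_zero fun r' hr' => hterm _ _ _ _ _ (fun e => hne e.2.1.2) hr'
  · exact fun h => absurd hi h
  · exact fun h _ hne => Finset.sum_eq_zero fun i _ => Finset.sum_eq_zero fun r _ =>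
      Finset.sum_eq_zero fun j _ => Finset.sum_eq_zero fun r' hr' =>
        hterm _ _ _ _ _ (fun e => hne e.1) hr'
  · exact fun h => absurd (Finset.mem_univ _) h

theorem response_apply {T : TaskAssignment S {s // s ∈ S}} (P : PowerAssignment T)
    (dec : ∀ W : Finset (Fin K), ({k // k ∈ W} → Matrix (Fin (α / m)) (Fin (γ / n)) F) →
      {s // s ∈ S} → Matrix (Fin α) (Fin γ) F) (k : Fin K) (u : Fin (α / m)) (v : Fin (γ / n)) :
    ((fcsaCode D P hm hp hn ρ dec).encA k A * (fcsaCode D P hm hp hn ρ dec).encB k B :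
      Matrix (Fin (α / m)) (Fin (γ / n)) F) u v =
    ∑ h : Fin (R / ρ), (encPartA D P hm hp ρ h A (D.point k) *
      encPartB D P hp hn ρ h B (D.point k)) u v := by
  change ((Matrix.of fun u w => encPartA D P hm hp ρ (finProdFinEquiv.symm w).1 A (D.point k) u
      (finProdFinEquiv.symm w).2 : Matrix (Fin (α / m)) (Fin (R / ρ * (β / p))) F) *
    (Matrix.of fun w v => encPartB D P hp hn ρ (finProdFinEquiv.symm w).1 B (D.point k)
      (finProdFinEquiv.symm w).2 v : Matrix (Fin (R / ρ * (β / p))) (Fin (γ / n)) F)) u v = _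
  simp only [Matrix.of_apply, Matrix.mul_apply]
  rw [← finProdFinEquiv.sum_comp, Fintype.sum_prod_type]
  simp only [Equiv.symm_apply_apply]

/-- Recovering `A_i^r * B_j^r` from as many responses as the threshold: interpolation of
`responsePoly` at the evaluation points and evaluation at the pole, which amounts to the product
with a Cauchy matrix between two diagonal matrices. -/
theorem mixBlocks_mul_eq_sum (hρ : 0 < ρ) (hR : ρ ∣ R) {ι : Type*} [DecidableEq ι]
    (W : Finset ι) (pt : ι → Fin K) (hpt : Function.Injective pt)
    (hW : (type1Threshold S R ρ).toNat ≤ W.card) (u : Fin (α / m)) (v : Fin (γ / n))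
    (t : Fin R × {s // s ∈ S}) :
    (mixBlocks hm hp (D.a t.1) (A t.2.1.1) * mixBlocks hp hn (D.b t.1) (B t.2.1.2)) u v =
      (residueFactor D ρ hR t)⁻¹ * (nodal W fun k => D.point (pt k)).eval (D.pole t) *
        ∑ k ∈ W, (D.pole t - D.point (pt k))⁻¹ *
          (nodalWeight W (fun k => D.point (pt k)) k *
            (nodal Finset.univ D.pole).eval (D.point (pt k)) *
            ∑ h : Fin (R / ρ), (encPartA D P hm hp ρ h A (D.point (pt k)) *
              encPartB D P hp hn ρ h B (D.point (pt k))) u v) := by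
  have hinj : Set.InjOn (fun k => D.point (pt k)) W :=
    ((point_injective D).comp hpt).injOn
  have h1 := eq_interpolate (f := responsePoly D hm hp hn ρ A B u v) hinj
    ((degree_responsePoly_lt D hm hp hn ρ A B hρ hR u v).trans_le (by exact_mod_cast hW))
  have h2 := eval_responsePoly_pole D hm hp hn ρ A B hR u v t
  rw [h1, eval_interpolate_not_at_node _ fun k _ => pole_ne_point D t (pt k)] at h2
  have h3 : ∀ k, (responsePoly D hm hp hn ρ A B u v).eval (D.point (pt k)) =
      (nodal Finset.univ D.pole).eval (D.point (pt k)) *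
        ∑ h : Fin (R / ρ), (encPartA D P hm hp ρ h A (D.point (pt k)) *
          encPartB D P hp hn ρ h B (D.point (pt k))) u v := fun k =>
    eval_responsePoly D P hm hp hn ρ A B u v fun t => (pole_ne_point D t (pt k)).symm
  simp only [h3] at h2
  rw [mul_assoc, eq_comm, inv_mul_eq_iff_eq_mul₀ (residueFactor_ne_zero D ρ hR t), ← h2]
  congr 1
  refine Finset.sum_congr rfl fun k _ => ?_
  ring

end Response

/-! ### The decoder and its complexity -/

section Decoder

open Polynomial Lagrange

/-- The number of operations for a Cauchy matrix of size at most `N`, in terms of `N`. -/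
theorem cauchy_cost_le {N : ℕ} (hN : 0 < N) :
    ((2 ^ Nat.clog 2 N * (10002 * (Nat.clog 2 N *
      (Nat.clog 2 N * Nat.clog 2 (Nat.clog 2 N + 1) + 1)) + 1) : ℕ) : ℝ) ≤
      2 * N + 1500000 * (N * logFactor N) := by
  set H := Nat.clog 2 N with hH
  set j := Nat.clog 2 (H + 1) with hj
  rcases Nat.lt_or_ge 1 N with h1 | h1
  swap
  · obtain rfl : N = 1 := by omega
    have : H = 0 := by simp [hH]
    rw [this]
    simp [logFactor]
  have hl2 := Real.log_two_gt_d9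
  have hH1 : 2 ^ (H - 1) < N := Nat.pow_pred_clog_lt_self (by omega) h1
  have hH0 : 0 < H := Nat.clog_pos (by omega) h1
  have hj1 : 2 ^ (j - 1) < H + 1 := Nat.pow_pred_clog_lt_self (by omega) (by omega)
  have hj0 : 0 < j := Nat.clog_pos (by omega) (by omega)
  have h2H : 2 ^ H ≤ 2 * N := by
    obtain ⟨e, he⟩ : ∃ e, H = e + 1 := ⟨H - 1, by omega⟩
    rw [he, Nat.add_sub_cancel] at hH1
    rw [he, pow_succ]
    omega
  set ℓ := Real.log N with hℓ
  set M := max 1 (Real.log ℓ) with hM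
  have hM1 : 1 ≤ M := le_max_left _ _
  have hMl : Real.log ℓ ≤ M := le_max_right _ _
  have hℓ2 : Real.log 2 ≤ ℓ := Real.log_le_log (by norm_num) (by exact_mod_cast h1)
  -- `H` is at most `3 log N`
  have hHℓ : (H : ℝ) ≤ 3 * ℓ := by
    have h3 : ((H - 1 : ℕ) : ℝ) * Real.log 2 ≤ ℓ := by
      rw [← Real.log_pow]
      refine Real.log_le_log (by positivity) ?_
      exact_mod_cast hH1.le
    rw [Nat.cast_sub hH0, Nat.cast_one] at h3
    nlinarith
  -- `j` is at most `7 max (1, log log N)`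
  have hjM : (j : ℝ) ≤ 7 * M := by
    have h3 : ((j - 1 : ℕ) : ℝ) * Real.log 2 ≤ Real.log (8 * ℓ) := by
      rw [← Real.log_pow]
      refine Real.log_le_log (by positivity) ?_
      have h4 : ((2 ^ (j - 1) : ℕ) : ℝ) ≤ ((H + 1 : ℕ) : ℝ) := by exact_mod_cast hj1.le
      push_cast at h4
      linarith
    have h5 : Real.log (8 * ℓ) = 3 * Real.log 2 + Real.log ℓ := by
      rw [Real.log_mul (by norm_num) (by linarith),
        show (8 : ℝ) = 2 ^ 3 by norm_num, Real.log_pow]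
      norm_num
    rw [h5, Nat.cast_sub hj0, Nat.cast_one] at h3
    nlinarith
  have hH1' : (1 : ℝ) ≤ H := by exact_mod_cast hH0
  have key : (H : ℝ) * (H * j + 1) ≤ 72 * (ℓ ^ 2 * M) := by
    have h3 : (H : ℝ) ^ 2 ≤ 9 * ℓ ^ 2 := by nlinarith
    have h4 : (H : ℝ) ^ 2 * j ≤ 9 * ℓ ^ 2 * (7 * M) :=
      mul_le_mul h3 hjM (Nat.cast_nonneg _) (by positivity)
    have h5 : (H : ℝ) ≤ 9 * ℓ ^ 2 * M := by
      calc (H : ℝ) ≤ (H : ℝ) ^ 2 := by nlinarith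
        _ ≤ 9 * ℓ ^ 2 := h3
        _ ≤ 9 * ℓ ^ 2 * M := le_mul_of_one_le_right (by positivity) hM1
    nlinarith
  have h2H' : (2 : ℝ) ^ H ≤ 2 * N := by exact_mod_cast h2H
  have hfac : logFactor N = ℓ ^ 2 * M := rfl
  rw [hfac]
  push_cast
  have hnn : 0 ≤ ℓ ^ 2 * M := by positivity
  calc (2 : ℝ) ^ H * (10002 * ((H : ℝ) * (H * j + 1)) + 1)
      ≤ 2 * N * (10002 * (72 * (ℓ ^ 2 * M)) + 1) := by gcongr
    _ ≤ 2 * N + 1500000 * (N * (ℓ ^ 2 * M)) := by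
      nlinarith [mul_nonneg (Nat.cast_nonneg (α := ℝ) N) hnn]

variable {F : Type*} [Field F] {LA LB α β γ m p n R K : ℕ} {S : Finset (Fin LA × Fin LB)}

/-- For every sufficiently large set of responding workers there is a correct decoding function
that is computed by a short program. -/
theorem exists_decoder (hS : S.Nonempty) (hα : 0 < α) (hγ : 0 < γ)
    (D : Setup F m p n R {s // s ∈ S} K) (P : PowerAssignment (type1Tasks S)) (hm : m ∣ α)
    (hp : p ∣ β) (hn : n ∣ γ) {ρ : ℕ} (hR0 : 0 < R) (hR : ρ ∣ R) (W : Finset (Fin K))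
    (hW : type1Threshold S R ρ ≤ (W.card : ℤ)) :
    ∃ d : ({k // k ∈ W} → Matrix (Fin (α / m)) (Fin (γ / n)) F) →
        {s // s ∈ S} → Matrix (Fin α) (Fin γ) F,
      (∀ (A : Fin LA → Matrix (Fin α) (Fin β) F) (B : Fin LB → Matrix (Fin β) (Fin γ) F),
        d (fun k => Matrix.of fun u v => ∑ h : Fin (R / ρ),
          (encPartA D P hm hp ρ h A (D.point k.1) *
            encPartB D P hp hn ρ h B (D.point k.1)) u v) = fun s => A s.1.1 * B s.1.2) ∧
      ComputableWithin (10000000 * ((α : ℝ) * γ * R * S.card +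
          (α : ℝ) * γ * (type1Threshold S R ρ : ℝ) * logFactor (type1Threshold S R ρ : ℝ)))
        (fun (y : (Σ _ : {k // k ∈ W}, Fin (α / m) × Fin (γ / n)) → F)
          (o : {s // s ∈ S} × Fin α × Fin γ) =>
            d (fun k => Matrix.of fun u v => y ⟨k, (u, v)⟩) o.1 o.2.1 o.2.2) := by
  classical
  have hρ : 0 < ρ := Nat.pos_of_dvd_of_pos hR hR0
  have hlo := le_type1Threshold (R := R) hS hρ
  have hhi := type1Threshold_le hS (Nat.le_of_dvd hR0 hR)
  obtain ⟨N, hN⟩ : ∃ N : ℕ, type1Threshold S R ρ = N :=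
    Int.eq_ofNat_of_zero_le ((Int.natCast_nonneg _).trans hlo)
  rw [hN] at hlo hhi hW
  have hloN : R * S.card ≤ N := by exact_mod_cast hlo
  have hhiN : N ≤ 2 * (R * S.card) := by exact_mod_cast hhi
  have hN0 : 0 < N := lt_of_lt_of_le (Nat.mul_pos hR0 hS.card_pos) hloN
  have hNW : N ≤ (Finset.univ : Finset {k // k ∈ W}).card := by
    rw [Finset.card_univ, Fintype.card_coe]
    exact_mod_cast hW
  -- `N` of the responses suffice
  obtain ⟨V, -, hV⟩ := Finset.exists_subset_card_eq hNW
  set pt : {k // k ∈ W} → F := fun k => D.point k.1 with hpt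
  -- `wt` and `sc` are the diagonal matrices on the two sides of the Cauchy matrix
  set wt : {k // k ∈ W} → F := fun k =>
    nodalWeight V pt k * (nodal Finset.univ D.pole).eval (pt k) with hwt
  set sc : Fin R × {s // s ∈ S} → F := fun t =>
    (residueFactor D ρ hR t)⁻¹ * (nodal V pt).eval (D.pole t) with hsc
  let rowIdx : Fin α → Fin m × Fin (α / m) := fun i =>
    finProdFinEquiv.symm (Fin.cast (Nat.mul_div_cancel' hm).symm i)
  let colIdx : Fin γ → Fin n × Fin (γ / n) := fun i =>
    finProdFinEquiv.symm (Fin.cast (Nat.mul_div_cancel' hn).symm i)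
  refine ⟨fun y s => Matrix.of fun i i' => ∑ r, D.c r (rowIdx i).1 (colIdx i').1 *
    (sc (r, s) * ∑ k ∈ V, (D.pole (r, s) - pt k)⁻¹ *
      (wt k * y k (rowIdx i).2 (colIdx i').2)), ?_, ?_⟩
  · intro A B
    funext s
    ext i i'
    have hi : Fin.cast (Nat.mul_div_cancel' hm) (finProdFinEquiv (rowIdx i)) = i := by
      simp only [rowIdx, Equiv.apply_symm_apply]
      rfl
    have hi' : Fin.cast (Nat.mul_div_cancel' hn) (finProdFinEquiv (colIdx i')) = i' := by
      simp only [colIdx, Equiv.apply_symm_apply]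
      rfl
    conv_rhs => rw [← hi, ← hi']
    have hblock := mul_apply_eq_sum_mixBlocks D.bilinear hm hp hn (A s.1.1) (B s.1.2)
      (rowIdx i).1 (colIdx i').1 (rowIdx i).2 (colIdx i').2
    refine Eq.trans ?_ hblock.symm
    change ∑ r : Fin R, _ = _
    refine Finset.sum_congr rfl fun r _ => ?_
    have hrec := mixBlocks_mul_eq_sum D P hm hp hn ρ A B hρ hR V (fun k => k.1)
      Subtype.val_injective (by rw [hN, hV, Int.toNat_natCast]) (rowIdx i).2 (colIdx i').2 (r, s)
    rw [hrec]
    rfl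
  · set Ω := (Σ _ : {k // k ∈ W}, Fin (α / m) × Fin (γ / n)) → F with hΩ
    set src : Set (Ω → F) := Set.range fun i y => y i with hsrc
    set H := Nat.clog 2 N with hH
    set j := Nat.clog 2 (H + 1) with hj
    -- the products `A_i^r * B_j^r`, entry by entry
    have entry : ∀ q : Fin (α / m) × Fin (γ / n), Reaches (Set.univ : Set F)
        ((fun t (y : Ω) => sc t * ∑ k ∈ V, (D.pole t - pt k)⁻¹ * (wt k * y ⟨k, q⟩)) ''
          (Finset.univ : Finset (Fin R × {s // s ∈ S})))
        src (N + 2 ^ H * (10002 * (H * (H * j + 1)) + 1) + R * S.card) := by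
      intro q
      have r1 := Reaches.image (A := (Set.univ : Set F)) (S := src) V
        (fun k (y : Ω) => wt k * y ⟨k, q⟩) (d := 1) fun k _ =>
          Reaches.smul (Set.mem_univ (wt k)) (u := fun y : Ω => y ⟨k, q⟩)
            (Set.mem_insert_of_mem _ ⟨_, rfl⟩)
      have hNH : N ≤ 2 ^ H := Nat.le_pow_clog (by omega) _
      have r2 := reaches_cauchy (H := H) (j := j) (Nat.le_pow_clog (by omega) _) pt D.pole
        (fun k (y : Ω) => wt k * y ⟨k, q⟩) V Finset.univ (hV.le.trans hNH)
        (by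
          rw [Finset.card_univ, Fintype.card_prod, Fintype.card_fin, Fintype.card_coe]
          exact hloN.trans hNH)
        fun t _ k _ => pole_ne_point D t k.1
      have r3 := Reaches.image (A := (Set.univ : Set F)) (S := ((fun t (y : Ω) =>
          ∑ k ∈ V, (D.pole t - pt k)⁻¹ * (wt k * y ⟨k, q⟩)) ''
          ((Finset.univ : Finset (Fin R × {s // s ∈ S})) : Set (Fin R × {s // s ∈ S}))))
        Finset.univ (fun t (y : Ω) => sc t * ∑ k ∈ V, (D.pole t - pt k)⁻¹ *
          (wt k * y ⟨k, q⟩)) (d := 1) fun t ht =>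
          Reaches.smul (Set.mem_univ (sc t))
            (u := fun y : Ω => ∑ k ∈ V, (D.pole t - pt k)⁻¹ * (wt k * y ⟨k, q⟩))
            (Set.mem_insert_of_mem _ ⟨t, Finset.mem_coe.2 ht, rfl⟩)
      refine ((r1.trans r2).trans r3).mono_cost (le_of_eq ?_)
      rw [hV, Finset.card_univ, Fintype.card_prod, Fintype.card_fin, Fintype.card_coe]
      ring
    have all := (Reaches.biUnion_const Finset.univ _ fun q _ => entry q).trans
      (Reaches.image (A := (Set.univ : Set F))
        (Finset.univ : Finset ({s // s ∈ S} × Fin α × Fin γ))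
        (fun o (y : Ω) => ∑ r, D.c r (rowIdx o.2.1).1 (colIdx o.2.2).1 *
          (sc (r, o.1) * ∑ k ∈ V, (D.pole (r, o.1) - pt k)⁻¹ *
            (wt k * y ⟨k, ((rowIdx o.2.1).2, (colIdx o.2.2).2)⟩))) (d := R) fun o _ => by
          have := Reaches.sum (A := (Set.univ : Set F))
            (S := ⋃ q ∈ (Finset.univ : Finset (Fin (α / m) × Fin (γ / n))),
              (fun t (y : Ω) => sc t * ∑ k ∈ V, (D.pole t - pt k)⁻¹ * (wt k * y ⟨k, q⟩)) ''
                ((Finset.univ : Finset (Fin R × {s // s ∈ S})) : Set (Fin R × {s // s ∈ S})))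
            (Finset.univ : Finset (Fin R))
            (fun r => D.c r (rowIdx o.2.1).1 (colIdx o.2.2).1)
            (fun r (y : Ω) => sc (r, o.1) * ∑ k ∈ V, (D.pole (r, o.1) - pt k)⁻¹ *
              (wt k * y ⟨k, ((rowIdx o.2.1).2, (colIdx o.2.2).2)⟩)) (Set.mem_univ _)
            (fun _ _ => Set.mem_univ _) (fun r _ => Set.mem_insert_of_mem _
              (Set.mem_biUnion (Finset.mem_coe.2 (Finset.mem_univ _))
                ⟨(r, o.1), by simp, rfl⟩))
          rw [Finset.card_univ, Fintype.card_fin] at this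
          refine this.of_eq (Set.singleton_eq_singleton_iff.2 (funext fun y => ?_))
          rw [Finset.sum_apply]
          rfl)
    refine (all.mono_tgt (T' := Set.range fun (o : {s // s ∈ S} × Fin α × Fin γ) (y : Ω) => _)
      ?_).computableWithin ?_
    · rintro _ ⟨o, rfl⟩
      exact Set.mem_insert_of_mem _ ⟨o, by simp, rfl⟩
    · have hdiv : α / m * (γ / n) ≤ α * γ :=
        Nat.mul_le_mul (Nat.div_le_self _ _) (Nat.div_le_self _ _)
      have hcost := cauchy_cost_le hN0
      rw [← hH, ← hj] at hcost
      set Q := 2 ^ H * (10002 * (H * (H * j + 1)) + 1) with hQ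
      simp only [Finset.card_univ, Fintype.card_prod, Fintype.card_fin, Fintype.card_coe]
      have hN' : (type1Threshold S R ρ : ℝ) = N := by rw [hN]; simp
      rw [hN']
      have e1 : α / m * (γ / n) * (N + Q + R * S.card) + S.card * (α * γ) * R ≤
          α * γ * (N + Q + 2 * (R * S.card)) := by
        calc _ ≤ α * γ * (N + Q + R * S.card) + S.card * (α * γ) * R := by gcongr
          _ = _ := by ring
      have e2 : ((α / m * (γ / n) * (N + Q + R * S.card) + S.card * (α * γ) * R : ℕ) : ℝ) ≤
          α * γ * (N + Q + 2 * (R * S.card)) := by exact_mod_cast e1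
      have e3 : (N : ℝ) ≤ 2 * (R * S.card) := by exact_mod_cast hhiN
      have e4 : (1 : ℝ) ≤ α * γ := by exact_mod_cast Nat.mul_pos hα hγ
      have e5 : (1 : ℝ) ≤ R * S.card := by exact_mod_cast Nat.mul_pos hR0 hS.card_pos
      have e6 : (0 : ℝ) ≤ N * logFactor N := by
        refine mul_nonneg (Nat.cast_nonneg _) (mul_nonneg (sq_nonneg _) ?_)
        exact zero_le_one.trans (le_max_left _ _)
      have e7 : (N : ℝ) + Q + 2 * (R * S.card) ≤
          8 * (R * S.card) + 1500000 * (N * logFactor N) := by linarith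
      have e8 := e2.trans (mul_le_mul_of_nonneg_left e7 (by linarith : (0 : ℝ) ≤ α * γ))
      have e9 : (1 : ℝ) ≤ α * γ * (R * S.card) := by nlinarith
      have e10 : (0 : ℝ) ≤ α * γ * (N * logFactor N) := mul_nonneg (by linarith) e6
      linarith

end Decoder

/-! ### The recovery threshold -/

section Threshold

variable {F : Type*} [Field F] {LA LB α β γ K : ℕ} {S : Finset (Fin LA × Fin LB)}

/-- A code that recovers from `N` responses, and whose decoders give up by returning zero when
there are fewer, has recovery threshold `N`: zero is wrong for suitable matrix units. -/
theorem Code.recoveryThreshold_eq {c : Code F α β γ S K} {N : ℕ} (hS : S.Nonempty) (hα : 0 < α)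
    (hβ : 0 < β) (hγ : 0 < γ) (hN : c.RecoversFrom N) (hNK : N ≤ K)
    (hdec : ∀ W : Finset (Fin K), W.card < N → ∀ y, c.dec W y = fun _ => 0) :
    c.recoveryThreshold = N := by
  refine le_antisymm (Nat.sInf_le hN) (le_csInf ⟨N, hN⟩ fun r hr => ?_)
  by_contra hlt
  obtain ⟨W, -, hW⟩ := Finset.exists_subset_card_eq
    (s := (Finset.univ : Finset (Fin K))) (n := r) (by simp; omega)
  obtain ⟨s, hs⟩ := hS
  have h := hr W (by rw [hW]) (fun _ => Matrix.single ⟨0, hα⟩ ⟨0, hβ⟩ 1)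
    (fun _ => Matrix.single ⟨0, hβ⟩ ⟨0, hγ⟩ 1)
  rw [hdec W (by omega)] at h
  have h0 := congrFun (congrFun (congrFun h ⟨s, hs⟩) ⟨0, hα⟩) ⟨0, hγ⟩
  simp at h0

end Threshold

end VCDBMM

theorem mainTheorem4 :
    ∃ C : ℝ, 0 < C ∧
      ∀ (F : Type*) [Field F] [Fintype F] (LA LB α β γ m p n ρ K : ℕ)
        (S : Finset (Fin LA × Fin LB)) (_hS : S.Nonempty)
        (_hα : 0 < α) (_hβ : 0 < β) (_hγ : 0 < γ) (_hm0 : 0 < m) (_hp0 : 0 < p) (_hn0 : 0 < n)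
        (hm : m ∣ α) (hp : p ∣ β) (hn : n ∣ γ)
        (_hρ : ρ ∣ VCDBMM.bilinearComplexity F m p n)
        (_hF : VCDBMM.bilinearComplexity F m p n * S.card + K < Fintype.card F),
        -- power assignments for the Type-1 tasks exist, and all their relevant powers are 1
        Nonempty (VCDBMM.PowerAssignment (VCDBMM.type1Tasks S)) ∧
        (∀ (P : VCDBMM.PowerAssignment (VCDBMM.type1Tasks S)) (s : {s // s ∈ S}),
          P.powA s s.1.1 = 1 ∧ P.powB s s.1.2 = 1) ∧
        -- the code can be set up
        Nonempty (VCDBMM.Setup F m p n (VCDBMM.bilinearComplexity F m p n) {s // s ∈ S} K) ∧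
        -- every such code has the stated threshold and decoding complexity
        ∀ (P : VCDBMM.PowerAssignment (VCDBMM.type1Tasks S))
          (D : VCDBMM.Setup F m p n (VCDBMM.bilinearComplexity F m p n) {s // s ∈ S} K),
          ∃ dec : ∀ W : Finset (Fin K),
              ({k // k ∈ W} → Matrix (Fin (α / m)) (Fin (γ / n)) F) →
                {s // s ∈ S} → Matrix (Fin α) (Fin γ) F,
            (VCDBMM.fcsaCode D P hm hp hn ρ dec).RecoversFrom
              (VCDBMM.type1Threshold S (VCDBMM.bilinearComplexity F m p n) ρ) ∧
            (VCDBMM.type1Threshold S (VCDBMM.bilinearComplexity F m p n) ρ ≤ K →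
              ((VCDBMM.fcsaCode D P hm hp hn ρ dec).recoveryThreshold : ℤ) =
                VCDBMM.type1Threshold S (VCDBMM.bilinearComplexity F m p n) ρ) ∧
            (VCDBMM.fcsaCode D P hm hp hn ρ dec).DecodesWithin
              (VCDBMM.type1Threshold S (VCDBMM.bilinearComplexity F m p n) ρ)
              (C * ((α : ℝ) * γ * VCDBMM.bilinearComplexity F m p n * S.card +
                (α : ℝ) * γ *
                  (VCDBMM.type1Threshold S (VCDBMM.bilinearComplexity F m p n) ρ : ℝ) *
                  VCDBMM.logFactor
                    (VCDBMM.type1Threshold S (VCDBMM.bilinearComplexity F m p n) ρ : ℝ))) := by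
  refine ⟨10000000, by norm_num, ?_⟩
  intro F _ _ LA LB α β γ m p n ρ K S hS hα hβ hγ hm0 hp0 hn0 hm hp hn hρ hF
  have hR0 : 0 < VCDBMM.bilinearComplexity F m p n := VCDBMM.bilinearComplexity_pos hm0 hp0 hn0
  refine ⟨VCDBMM.nonempty_powerAssignment_type1, fun P s => ?_,
    VCDBMM.nonempty_setup (by rwa [Fintype.card_coe]), fun P D => ?_⟩
  · rw [P.powA_type1, P.powB_type1, if_pos rfl, if_pos rfl]
    exact ⟨rfl, rfl⟩
  classical
  choose d hd using fun (W : Finset (Fin K)) hW =>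
    VCDBMM.exists_decoder hS hα hγ D P hm hp hn hR0 hρ W hW
  -- with too few responses the decoder gives up and returns zero
  let dec : ∀ W : Finset (Fin K), ({k // k ∈ W} → Matrix (Fin (α / m)) (Fin (γ / n)) F) →
      {s // s ∈ S} → Matrix (Fin α) (Fin γ) F := fun W =>
    if hW : VCDBMM.type1Threshold S (VCDBMM.bilinearComplexity F m p n) ρ ≤ (W.card : ℤ)
    then d W hW else fun _ _ => 0
  have hrec : (VCDBMM.fcsaCode D P hm hp hn ρ dec).RecoversFrom
      (VCDBMM.type1Threshold S (VCDBMM.bilinearComplexity F m p n) ρ) := by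
    intro W hW A B
    have hdec : dec W = d W hW := dif_pos hW
    change dec W _ = _
    rw [hdec, ← (hd W hW).1 A B]
    congr 1
    funext k
    ext u v
    exact VCDBMM.response_apply D hm hp hn ρ A B P dec k.1 u v
  refine ⟨dec, hrec, fun hK => ?_, fun W hW => ?_⟩
  · obtain ⟨N, hN⟩ := Int.eq_ofNat_of_zero_le ((Int.natCast_nonneg _).trans
      (VCDBMM.le_type1Threshold (R := VCDBMM.bilinearComplexity F m p n) hS
        (Nat.pos_of_dvd_of_pos hρ hR0)))
    rw [hN] at hK hrec ⊢
    congr 1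
    refine VCDBMM.Code.recoveryThreshold_eq hS hα hβ hγ hrec (by exact_mod_cast hK) ?_
    intro W hW y
    have hdec : dec W = fun _ _ => 0 := dif_neg (by rw [hN]; omega)
    change dec W y = _
    rw [hdec]
  · have hdec : dec W = d W hW := dif_pos hW
    have h := (hd W hW).2
    rw [← hdec] at h
    exact h
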